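/- **Theorem 3.1.** Let $N\ge 1$ and let $a$ be a finite positive Borel measure on $(0,2]$ (written $a(\alpha)\,d\alpha$; it may be a positive integrable function or a positive generalized function), with $a((0,2])>0$ and $a(\{2\})=0$; the last condition holds if $a$ is an integrable function, and also if $2$ is not in the singular support of the distribution $a$. For $0<\alpha\le 2$ let $D_0^\alpha$ be the pseudo-differential operator on $\mathbb R^N$ with symbol $-|\xi|^\alpha$, and put $$b(\alpha)=\frac{\alpha\,\Gamma(\frac{\alpha}{2})\,\Gamma(\frac{N+\alpha}{2})\,\sin\frac{\alpha\pi}{2}}{2^{2-\alpha}\pi^{1+N/2}},\qquad Q_m(h)=\int_0^2 |m|^{-\alpha}\,\frac{a(\alpha)b(\alpha)}{h^\alpha}\,d\alpha\quad(0\ne m\in\mathbb Z^N,\ h>0),$$ $$\sigma(\tau,h)=2\tau\sum_{m\neq 0}\frac{Q_m(h)}{|m|^N},\qquad \mathcal B(\xi)=-\int_0^2 a(\alpha)|\xi|^\alpha\,d\alpha .$$ Fix $t>0$ and let $h_n>0$ $(n\ge 0)$ satisfy $h_n\to 0$ and $\sigma(t/n,h_n)\le 1$ for all $n\ge 1$.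 For each $n\ge1$ put $\tau=t/n$, $h=h_n$, and let $\mathbf X^{(n)}_1,\dots,\mathbf X^{(n)}_n$ be independent $\mathbb Z^N$-valued random vectors with $$P(\mathbf X^{(n)}_i=k)=p_k=\begin{cases}1-\sigma(\tau,h), & k=0,\\[2pt] 2\tau\,Q_k(h)/|k|^N, & k\ne 0.\end{cases}$$ Let $G(s,x)=F^{-1}(e^{s\mathcal B(\xi)})(x)=(2\pi)^{-N}\int_{\mathbb R^N}e^{s\mathcal B(\xi)}e^{ix\cdot\xi}\,d\xi$ for $s>0$. Then: 1. $G$ is real-valued and is a fundamental solution of $$\frac{\partial}{\partial t}u(t,x)=\int_0^2 a(\alpha)D_0^\alpha u(t,x)\,d\alpha,\qquad t>0,\ x\in\mathbb R^N,\qquad u(0,x)=\delta(x),$$ in the following weak sense: $G(s,\cdot)\in L^1(\mathbb R^N)$ for $s>0$, and for every rapidly decreasing $\varphi\in\mathcal S(\mathbb R^N)$ $$\frac{d}{ds}\int G(s,x)\varphi(x)\,dx=\int G(s,x)\Big(\int_0^2 a(\alpha)D_0^\alpha\varphi(x)\,d\alpha\Big)dx\quad(s>0),\qquad \lim_{s\to0+}\int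 G(s,x)\varphi(x)\,dx=\varphi(0).$$ 2. $G(t,\cdot)$ is a probability density function on $\mathbb R^N$. 3. The sums $\mathbf S_n=h_n\mathbf X^{(n)}_1+\dots+h_n\mathbf X^{(n)}_n$ converge in law, as $n\to\infty$, to a random vector with probability density function $G(t,\cdot)$. -/

import Mathlib

open MeasureTheory ProbabilityTheory Filter Topology Set
open scoped SchwartzMap

noncomputable section

namespace DistributedWalk

/-- `ℝ^N` with the Euclidean norm. -/
abbrev Space (N : ℕ) : Type := EuclideanSpace ℝ (Fin N)

/-- The node `(h k₁, …, h k_N)` of the lattice `(hℤ)^N`. -/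
def node {N : ℕ} (h : ℝ) (k : Fin N → ℤ) : Space N :=
  WithLp.toLp 2 (fun i => h * (k i : ℝ))

/-- The Euclidean norm `|k|` of `k ∈ ℤ^N`. -/
def latticeNorm {N : ℕ} (k : Fin N → ℤ) : ℝ := ‖node 1 k‖

/-- The norming constant `b(α)` of the hypersingular integral
`D_0^α f(x) = b(α) ∫ (f(x+y) - 2 f(x) + f(x-y)) / |y|^(N+α) dy`, `0 < α < 2`. -/
def normingConst (N : ℕ) (α : ℝ) : ℝ :=
  α * Real.Gamma (α / 2) * Real.Gamma (((N : ℝ) + α) / 2) * Real.sin (α * Real.pi / 2) /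
    ((2 : ℝ) ^ (2 - α) * Real.pi ^ (1 + (N : ℝ) / 2))

/-- `Q_m(h) = ∫_0^2 |m|^(-α) b(α) h^(-α) a(α) dα`; the positive generalized function `a(α) dα` is
the measure `a`. -/
def Q {N : ℕ} (a : Measure ℝ) (h : ℝ) (m : Fin N → ℤ) : ℝ :=
  ∫ α in Ioc 0 2, latticeNorm m ^ (-α) * (normingConst N α / h ^ α) ∂a

/-- `σ(τ, h) = 2 τ ∑_{m ≠ 0} Q_m(h) / |m|^N`. For `h > 0` and a finite measure `a` the series always
converges, as `b(α) ∑_{m ≠ 0} |m|^(-N-α)` is bounded for `0 < α < 2` and `b(2) = 0`. -/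
def sigma (N : ℕ) (a : Measure ℝ) (τ h : ℝ) : ℝ :=
  2 * τ * ∑' m : {m : Fin N → ℤ // m ≠ 0}, Q a h m.1 / latticeNorm m.1 ^ N

open Classical in
/-- The transition probabilities `p_k`, `k ∈ ℤ^N`. -/
def transitionProb {N : ℕ} (a : Measure ℝ) (τ h : ℝ) (k : Fin N → ℤ) : ℝ :=
  if k = 0 then 1 - sigma N a τ h else 2 * τ * (Q a h k / latticeNorm k ^ N)

/-- The Fourier transform `F f (ξ) = ∫ f(x) e^{-i x·ξ} dx`. -/
def fourierF {N : ℕ} (f : Space N → ℂ) (ξ : Space N) : ℂ :=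
  ∫ x, f x * Complex.exp (-(Complex.I * ((inner ℝ x ξ : ℝ) : ℂ)))

/-- The inverse Fourier transform `F⁻¹ g (x) = (2π)^(-N) ∫ g(ξ) e^{i x·ξ} dξ`. -/
def invFourierF {N : ℕ} (g : Space N → ℂ) (x : Space N) : ℂ :=
  (((2 * Real.pi) ^ N : ℝ) : ℂ)⁻¹ * ∫ ξ, g ξ * Complex.exp (Complex.I * ((inner ℝ x ξ : ℝ) : ℂ))

/-- `D_0^α φ`: the pseudo-differential operator with symbol `-|ξ|^α`. -/
def fracLaplacian {N : ℕ} (α : ℝ) (φ : 𝓢(Space N, ℂ)) (x : Space N) : ℂ :=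
  invFourierF (fun ξ => ((-(‖ξ‖ ^ α) : ℝ) : ℂ) * fourierF φ ξ) x

/-- The distributed order operator `∫_0^2 a(α) D_0^α φ dα`. -/
def distributedOp {N : ℕ} (a : Measure ℝ) (φ : 𝓢(Space N, ℂ)) (x : Space N) : ℂ :=
  ∫ α in Ioc 0 2, fracLaplacian α φ x ∂a

/-- The symbol `B(ξ) = - ∫_0^2 a(α) |ξ|^α dα`. -/
def symbol {N : ℕ} (a : Measure ℝ) (ξ : Space N) : ℝ :=
  -∫ α in Ioc 0 2, ‖ξ‖ ^ α ∂a

/-- `u` is a fundamental solution of `∂u/∂t = ∫_0^2 a(α) D_0^α u dα` on `t > 0`, `x ∈ ℝ^N`: the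
equation holds in the weak sense, tested against rapidly decreasing functions of `x` (the operator is
its own transpose, as its symbol is even), and `u(0, ·) = δ`. -/
structure IsFundamentalSolution {N : ℕ} (a : Measure ℝ) (u : ℝ → Space N → ℝ) : Prop where
  integrable : ∀ t, 0 < t → Integrable (u t)
  weak_eq : ∀ (φ : 𝓢(Space N, ℂ)) (t : ℝ), 0 < t →
    HasDerivAt (fun s => ∫ x, (u s x : ℂ) * φ x) (∫ x, (u t x : ℂ) * distributedOp a φ x) t
  initial : ∀ φ : 𝓢(Space N, ℂ),
    Tendsto (fun s => ∫ x, (u s x : ℂ) * φ x) (𝓝[>] 0) (𝓝 (φ 0))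

/-- `G(t, ·) = F⁻¹(e^{t B})` (its real part; that it is real-valued is part of the theorem). -/
def G {N : ℕ} (a : Measure ℝ) (t : ℝ) (x : Space N) : ℝ :=
  (invFourierF (fun ξ => Complex.exp ((t * symbol a ξ : ℝ) : ℂ)) x).re

/-- `f` is a probability density function on `ℝ^N`. -/
structure IsProbabilityDensity {N : ℕ} (f : Space N → ℝ) : Prop where
  nonneg : ∀ x, 0 ≤ f x
  integrable : Integrable f
  integral_eq_one : ∫ x, f x = 1

end DistributedWalk

end

open DistributedWalk

/-! The law of a step is symmetric, so its characteristic function is real, namely 1 - τ E_h(ξ) with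
E_h(ξ) = ∑_{m≠0} 2 Q_m(h) |m|^(-N) (1 - cos⟨hm, ξ⟩) (`charFun_map_node`). As h^N |hm|^(-N-α) =
|m|^(-N-α) h^(-α), E_h is a Riemann sum of mesh h for the kernel 2 b(α) (1 - cos⟨y, ξ⟩) |y|^(-N-α),
integrated against a(dα). The constant b(α) makes the integral of this kernel over y equal to |ξ|^α
when α < 2 (`lintegral_levyKernel`). Dominated convergence, in y and then in α, gives E_h → -B
(`tendsto_latticeExponent`), so the characteristic function of the walk, (1 - (t/n) E_h)^n, tends to
e^{tB}.

It remains to see that e^{tB} is the characteristic function of the density G(t, ·). Some ε > 0 has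
a([ε, 2]) > 0, so B(ξ) ≤ -c|ξ|^ε for |ξ| ≥ 1 and e^{sB} is integrable (`integrable_exp_symbol`). For
every s > 0, not only s = t, e^{sB} is a pointwise limit of characteristic functions, obtained by
slowing the walk down (`exists_tendsto_charFun`). Regularizing with Gaussians then gives G(s, ·) ≥ 0
(`integral_mul_cos_nonneg`) and, by Fatou, G(s, ·) ∈ L¹ (`integrable_integral_mul_cos`). Fourier
inversion recovers e^{sB} as the transform of G(s, ·); its value at 0 is the total mass 1, and
Lévy's continuity theorem gives the convergence in law.

The weak equation is read on the Fourier side: by Parseval, ∫ G(s, ·)φ is a constant times ∫ e^{sB}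
F φ, which is differentiated under the integral sign. -/

namespace DistributedWalk

/-! ### The integral of (1 - cos⟨y, ξ⟩)|y|^(-d-α) by Gaussian subordination. -/

section StableIntegral

/-- A Bochner integral of a non-integrable function is 0 by convention, so a nonzero value already
proves integrability. Closed formulas thus pass to `lintegral`, where Tonelli is free. -/
lemma lintegral_ofReal_of_integral_eq {X : Type*} [MeasurableSpace X] {μ : Measure X} {f : X → ℝ}
    {c : ℝ} (hf : 0 ≤ᵐ[μ] f) (hc : c ≠ 0) (h : ∫ x, f x ∂μ = c) :
    ∫⁻ x, ENNReal.ofReal (f x) ∂μ = ENNReal.ofReal c := by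
  rw [← h, ofReal_integral_eq_lintegral_ofReal _ hf]
  by_contra hn
  exact hc (h ▸ integral_undef hn)

/-- The substitution r = 1/u turns this into Euler's integral for Γ(1 - s). -/
lemma lintegral_rpow_mul_exp_neg_div {s v : ℝ} (hs1 : s < 1) (hv : 0 < v) :
    ∫⁻ r in Ioi (0 : ℝ), ENNReal.ofReal (r ^ (s - 2) * Real.exp (-(v / r))) =
      ENNReal.ofReal (Real.Gamma (1 - s) * v ^ (s - 1)) := by
  apply lintegral_ofReal_of_integral_eq
  · filter_upwards [self_mem_ae_restrict measurableSet_Ioi] with r hr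
    have : 0 < r := hr
    simp only [Pi.zero_apply]; positivity
  · exact (mul_pos (Real.Gamma_pos_of_pos (by linarith)) (Real.rpow_pos_of_pos hv _)).ne'
  · have h1 := integral_comp_rpow_Ioi (fun u : ℝ => u ^ ((1 - s) - 1) * Real.exp (-(v * u)))
      (p := -1) (by norm_num)
    rw [Real.integral_rpow_mul_exp_neg_mul_Ioi (by linarith) hv] at h1
    rw [one_div, Real.inv_rpow hv.le, ← Real.rpow_neg hv.le, neg_sub, mul_comm] at h1
    rw [← h1]
    apply setIntegral_congr_fun measurableSet_Ioi
    intro r hr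
    have hr : 0 < r := hr
    simp only [smul_eq_mul, abs_neg, abs_one, one_mul]
    rw [Real.rpow_neg_one r, Real.inv_rpow hr.le, ← Real.rpow_neg hr.le, ← mul_assoc,
      ← Real.rpow_add hr, div_eq_mul_inv]
    congr 2
    ring

/-- Write 1 - e^{-c/r} = ∫_0^c r⁻¹ e^{-v/r} dv and apply Tonelli. -/
lemma lintegral_rpow_mul_one_sub_exp {s c : ℝ} (hs0 : 0 < s) (hs1 : s < 1) (hc : 0 ≤ c) :
    ∫⁻ r in Ioi (0 : ℝ), ENNReal.ofReal (r ^ (s - 1) * (1 - Real.exp (-(c / r)))) =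
      ENNReal.ofReal (c ^ s / s * Real.Gamma (1 - s)) := by
  rcases hc.eq_or_lt with rfl | hc
  · simp [hs0.ne']
  have hΓ := Real.Gamma_pos_of_pos (show 0 < 1 - s by linarith)
  have key : ∀ r ∈ Ioi (0 : ℝ), ENNReal.ofReal (r ^ (s - 1) * (1 - Real.exp (-(c / r)))) =
      ∫⁻ v in Ioc 0 c, ENNReal.ofReal (r ^ (s - 2) * Real.exp (-(v / r))) := by
    intro r hr
    have hr : 0 < r := hr
    have hlt : Real.exp (-(c / r)) < 1 := by
      rw [Real.exp_lt_one_iff]; have := div_pos hc hr; linarith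
    symm
    apply lintegral_ofReal_of_integral_eq
    · exact .of_forall fun v => by simp only [Pi.zero_apply]; positivity
    · exact (mul_pos (Real.rpow_pos_of_pos hr _) (by linarith)).ne'
    · rw [← intervalIntegral.integral_of_le hc.le]
      have hd : ∀ v ∈ uIcc 0 c, HasDerivAt (fun v => -(r ^ (s - 1) * Real.exp (-(v / r))))
          (r ^ (s - 2) * Real.exp (-(v / r))) v := by
        intro v _
        have := ((((hasDerivAt_id v).div_const r).neg.exp).const_mul (r ^ (s - 1))).neg
        refine HasDerivAt.congr_deriv (f := fun v => -(r ^ (s - 1) * Real.exp (-(v / r)))) this ?_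
        rw [show s - 2 = s - 1 + -1 by ring, Real.rpow_add hr, Real.rpow_neg_one]
        simp only [id, Pi.neg_apply, one_div]
        ring
      rw [intervalIntegral.integral_eq_sub_of_hasDerivAt hd
        (Continuous.intervalIntegrable (by fun_prop) _ _)]
      simp only [zero_div, neg_zero, Real.exp_zero]
      ring
  rw [setLIntegral_congr_fun measurableSet_Ioi key]
  rw [lintegral_lintegral_swap]
  · rw [setLIntegral_congr_fun measurableSet_Ioc
      (fun v hv => lintegral_rpow_mul_exp_neg_div hs1 hv.1)]
    apply lintegral_ofReal_of_integral_eq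
    · filter_upwards [self_mem_ae_restrict measurableSet_Ioc] with v hv
      exact mul_nonneg hΓ.le (Real.rpow_nonneg hv.1.le _)
    · positivity
    · rw [integral_const_mul, ← intervalIntegral.integral_of_le hc.le,
        integral_rpow (Or.inl (by linarith)), sub_add_cancel, Real.zero_rpow hs0.ne', sub_zero,
        mul_comm]
  · refine Measurable.aemeasurable ?_
    simp only [Function.uncurry_def]
    fun_prop

variable {V : Type*} [NormedAddCommGroup V] [InnerProductSpace ℝ V] [FiniteDimensional ℝ V]
  [MeasurableSpace V] [BorelSpace V]

lemma integrable_exp_neg_mul_sq_norm {r : ℝ} (hr : 0 < r) :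
    Integrable (fun y : V => Real.exp (-r * ‖y‖ ^ 2)) := by
  by_contra hn
  have h := GaussianFourier.integral_rexp_neg_mul_sq_norm (V := V) hr
  rw [integral_undef hn] at h
  exact (Real.rpow_pos_of_pos (div_pos Real.pi_pos hr) _).ne h

lemma integral_exp_neg_mul_sq_norm_mul_cos {r : ℝ} (hr : 0 < r) (ξ : V) :
    ∫ y : V, Real.exp (-r * ‖y‖ ^ 2) * Real.cos (inner ℝ y ξ) =
      (Real.pi / r) ^ (Module.finrank ℝ V / 2 : ℝ) * Real.exp (-(‖ξ‖ ^ 2 / 4 / r)) := by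
  have h := GaussianFourier.integral_cexp_neg_mul_sq_norm_add (V := V) (b := (r : ℂ))
    (by simpa using hr) Complex.I ξ
  have hi := GaussianFourier.integrable_cexp_neg_mul_sq_norm_add (V := V) (b := (r : ℂ))
    (by simpa using hr) Complex.I ξ
  have h2 := congrArg Complex.re h
  rw [← RCLike.re_eq_complex_re, ← integral_re hi] at h2
  have e : ∀ y : V, RCLike.re (Complex.exp (-(r : ℂ) * (‖y‖ : ℂ) ^ 2 + Complex.I * (inner ℝ ξ y : ℝ)))
      = Real.exp (-r * ‖y‖ ^ 2) * Real.cos (inner ℝ y ξ) := by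
    intro y
    rw [RCLike.re_eq_complex_re, Complex.exp_re, real_inner_comm]
    congr 2
    · simp [← Complex.ofReal_pow]
    · simp [← Complex.ofReal_pow]
  simp_rw [e] at h2
  rw [h2, RCLike.re_eq_complex_re]
  have : ((Real.pi : ℂ) / r) ^ (Module.finrank ℝ V / 2 : ℂ) *
      Complex.exp (Complex.I ^ 2 * (‖ξ‖ : ℂ) ^ 2 / (4 * r)) =
      (((Real.pi / r) ^ (Module.finrank ℝ V / 2 : ℝ) * Real.exp (-(‖ξ‖ ^ 2 / 4 / r)) : ℝ) : ℂ) := by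
    push_cast [Complex.ofReal_cpow (div_pos Real.pi_pos hr).le]
    rw [Complex.I_sq]
    congr 2
    have : (r : ℂ) ≠ 0 := by exact_mod_cast hr.ne'
    field_simp
  rw [this, Complex.ofReal_re]

lemma lintegral_one_sub_cos_mul_exp {r : ℝ} (hr : 0 < r) (ξ : V) :
    ∫⁻ y : V, ENNReal.ofReal ((1 - Real.cos (inner ℝ y ξ)) * Real.exp (-r * ‖y‖ ^ 2)) =
      ENNReal.ofReal ((Real.pi / r) ^ (Module.finrank ℝ V / 2 : ℝ) *
        (1 - Real.exp (-(‖ξ‖ ^ 2 / 4 / r)))) := by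
  have hi := integrable_exp_neg_mul_sq_norm (V := V) hr
  have hi2 : Integrable (fun y : V => Real.exp (-r * ‖y‖ ^ 2) * Real.cos (inner ℝ y ξ)) := by
    refine hi.mono' (by fun_prop) (.of_forall fun y => ?_)
    rw [norm_mul, Real.norm_of_nonneg (Real.exp_pos _).le]
    exact mul_le_of_le_one_right (Real.exp_pos _).le (Real.abs_cos_le_one _)
  have e : ∀ y : V, (1 - Real.cos (inner ℝ y ξ)) * Real.exp (-r * ‖y‖ ^ 2) =
      Real.exp (-r * ‖y‖ ^ 2) - Real.exp (-r * ‖y‖ ^ 2) * Real.cos (inner ℝ y ξ) := by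
    intro y; ring
  simp_rw [e]
  have h3 := ofReal_integral_eq_lintegral_ofReal (hi.sub hi2) (.of_forall fun y => by
    simp only [Pi.zero_apply, Pi.sub_apply]
    rw [← e]
    exact mul_nonneg (by linarith [Real.cos_le_one (inner ℝ y ξ)]) (Real.exp_pos _).le)
  simp only [Pi.sub_apply] at h3
  rw [← h3, integral_sub hi hi2,
    GaussianFourier.integral_rexp_neg_mul_sq_norm hr, integral_exp_neg_mul_sq_norm_mul_cos hr]
  ring_nf

/-- Euler's integral shows a negative power of x to be a mixture of Gaussians; this reduces the Lévy
integral to Gaussian Fourier transforms. -/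
lemma ofReal_rpow_neg_eq_lintegral {p x : ℝ} (hp : 0 < p) (hx : 0 < x) :
    ENNReal.ofReal (x ^ (-(2 * p)) * Real.Gamma p) =
      ∫⁻ r in Ioi (0 : ℝ), ENNReal.ofReal (r ^ (p - 1) * Real.exp (-r * x ^ 2)) := by
  symm
  apply lintegral_ofReal_of_integral_eq
  · filter_upwards [self_mem_ae_restrict measurableSet_Ioi] with r hr
    have : 0 < r := hr
    simp only [Pi.zero_apply]; positivity
  · exact (mul_pos (Real.rpow_pos_of_pos hx _) (Real.Gamma_pos_of_pos hp)).ne'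
  · have := Real.integral_rpow_mul_exp_neg_mul_Ioi hp (pow_pos hx 2)
    rw [one_div, ← Real.rpow_natCast, ← Real.rpow_neg hx.le, ← Real.rpow_mul hx.le] at this
    rw [show -(2 * p) = -((2 : ℕ) : ℝ) * p by push_cast; ring, ← this]
    congr 1; ext r
    rw [Real.rpow_natCast]; ring_nf

/-- The Lévy integral of `(1 - cos ⟨y, ξ⟩) / |y|^(d + α)`. -/
lemma lintegral_one_sub_cos_mul_rpow [Nontrivial V] {α : ℝ} (h0 : 0 < α) (h2 : α < 2) (ξ : V) :
    ∫⁻ y : V, ENNReal.ofReal ((1 - Real.cos (inner ℝ y ξ)) *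
        ‖y‖ ^ (-((Module.finrank ℝ V : ℝ) + α)) *
          Real.Gamma (((Module.finrank ℝ V : ℝ) + α) / 2)) =
      ENNReal.ofReal (Real.pi ^ (Module.finrank ℝ V / 2 : ℝ) *
        ((‖ξ‖ ^ 2 / 4) ^ (α / 2) / (α / 2) * Real.Gamma (1 - α / 2))) := by
  set d : ℝ := (Module.finrank ℝ V : ℝ) with hd
  have hd0 : 0 ≤ d := Nat.cast_nonneg _
  have hp : 0 < (d + α) / 2 := by linarith
  have e1 : ∀ᵐ y : V, ENNReal.ofReal ((1 - Real.cos (inner ℝ y ξ)) * ‖y‖ ^ (-(d + α)) *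
      Real.Gamma ((d + α) / 2)) = ∫⁻ r in Ioi (0 : ℝ), ENNReal.ofReal (r ^ ((d + α) / 2 - 1)) *
        ENNReal.ofReal ((1 - Real.cos (inner ℝ y ξ)) * Real.exp (-r * ‖y‖ ^ 2)) := by
    have : ∀ᵐ y : V, y ≠ 0 := by
      rw [ae_iff]; simp
    filter_upwards [this] with y hy
    have hc : 0 ≤ 1 - Real.cos (inner ℝ y ξ) := by linarith [Real.cos_le_one (inner ℝ y ξ)]
    rw [mul_assoc, ENNReal.ofReal_mul hc, show -(d + α) = -(2 * ((d + α) / 2)) by ring,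
      ofReal_rpow_neg_eq_lintegral hp (norm_pos_iff.2 hy), ← lintegral_const_mul _ (by fun_prop)]
    apply setLIntegral_congr_fun measurableSet_Ioi
    intro r hr
    have hr : 0 < r := hr
    simp only
    rw [← ENNReal.ofReal_mul hc, ← ENNReal.ofReal_mul (Real.rpow_nonneg hr.le _)]
    congr 1; ring
  rw [lintegral_congr_ae e1, lintegral_lintegral_swap]
  · have e2 : ∀ r ∈ Ioi (0 : ℝ), ∫⁻ y : V, ENNReal.ofReal (r ^ ((d + α) / 2 - 1)) *
        ENNReal.ofReal ((1 - Real.cos (inner ℝ y ξ)) * Real.exp (-r * ‖y‖ ^ 2)) =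
        ENNReal.ofReal (Real.pi ^ (d / 2)) *
          ENNReal.ofReal (r ^ (α / 2 - 1) * (1 - Real.exp (-(‖ξ‖ ^ 2 / 4 / r)))) := by
      intro r hr
      have hr : 0 < r := hr
      rw [lintegral_const_mul _ (by fun_prop), lintegral_one_sub_cos_mul_exp hr,
        ← ENNReal.ofReal_mul (Real.rpow_nonneg hr.le _),
        ← ENNReal.ofReal_mul (Real.rpow_nonneg Real.pi_pos.le _), ← hd,
        Real.div_rpow Real.pi_pos.le hr.le]
      congr 1
      -- The factor r^(d/2) of the mixing weight cancels the r^(-d/2) of the Gaussian normalization,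
      -- so the dimension survives only in π^(d/2).
      rw [show (d + α) / 2 - 1 = d / 2 + (α / 2 - 1) by ring, Real.rpow_add hr]
      have := (Real.rpow_pos_of_pos hr (d / 2)).ne'
      field_simp
    rw [setLIntegral_congr_fun measurableSet_Ioi e2, lintegral_const_mul _ (by fun_prop),
      lintegral_rpow_mul_one_sub_exp (by linarith) (by linarith) (by positivity),
      ← ENNReal.ofReal_mul (Real.rpow_nonneg Real.pi_pos.le _)]
  · refine Measurable.aemeasurable ?_
    simp only [Function.uncurry_def]
    fun_prop

end StableIntegral

/-! ### The norming constant, the Lévy kernel and a majorant uniform in α. -/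

section LevyKernel

lemma normingConst_nonneg (N : ℕ) {α : ℝ} (hα : α ∈ Ioc (0 : ℝ) 2) : 0 ≤ normingConst N α := by
  obtain ⟨h0, h2⟩ := hα
  have hs : 0 ≤ Real.sin (α * Real.pi / 2) :=
    Real.sin_nonneg_of_nonneg_of_le_pi (by positivity) (by nlinarith [Real.pi_pos])
  have h1 := Real.Gamma_pos_of_pos (show 0 < α / 2 by linarith)
  have h3 := Real.Gamma_pos_of_pos (show 0 < ((N : ℝ) + α) / 2 by positivity)
  unfold normingConst
  positivity

lemma continuousOn_normingConst (N : ℕ) : ContinuousOn (normingConst N) (Ioc 0 2) := by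
  have hΓ : ∀ x : ℝ, 0 < x → ContinuousAt Real.Gamma x := fun x hx =>
    (Real.differentiableAt_Gamma fun m => by
      have : (0 : ℝ) ≤ m := Nat.cast_nonneg m
      linarith).continuousAt
  intro α hα
  apply ContinuousAt.continuousWithinAt
  have h0 : 0 < α := hα.1
  have c1 : ContinuousAt (fun α : ℝ => Real.Gamma (α / 2)) α :=
    ContinuousAt.comp (f := fun α : ℝ => α / 2) (hΓ _ (by linarith)) (by fun_prop)
  have c2 : ContinuousAt (fun α : ℝ => Real.Gamma (((N : ℝ) + α) / 2)) α :=
    ContinuousAt.comp (f := fun α : ℝ => ((N : ℝ) + α) / 2) (hΓ _ (by positivity)) (by fun_prop)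
  have c3 : ContinuousAt (fun α : ℝ => (2 : ℝ) ^ (2 - α) * Real.pi ^ (1 + (N : ℝ) / 2)) α :=
    (continuousAt_const.rpow (by fun_prop) (Or.inl (by norm_num))).mul continuousAt_const
  unfold normingConst
  refine ContinuousAt.div (((continuousAt_id.mul c1).mul c2).mul (by fun_prop)) c3 ?_
  have := Real.pi_pos
  positivity

/-- The pole of Γ(α/2) at 0 is removable: αΓ(α/2) = 2Γ(α/2 + 1) extends b continuously to the
compact interval [0, 2]. -/
lemma exists_normingConst_le (N : ℕ) (hN : 1 ≤ N) :
    ∃ C : ℝ, ∀ α ∈ Ioc (0 : ℝ) 2, normingConst N α ≤ C := by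
  have hN' : (1 : ℝ) ≤ N := by exact_mod_cast hN
  have hΓ : ∀ x : ℝ, 0 < x → ContinuousAt Real.Gamma x := fun x hx =>
    (Real.differentiableAt_Gamma fun m => by
      have : (0 : ℝ) ≤ m := Nat.cast_nonneg m
      linarith).continuousAt
  let f : ℝ → ℝ := fun α => 2 * Real.Gamma (α / 2 + 1) * Real.Gamma (((N : ℝ) + α) / 2) *
    Real.sin (α * Real.pi / 2) / ((2 : ℝ) ^ (2 - α) * Real.pi ^ (1 + (N : ℝ) / 2))
  have hf : ContinuousOn f (Icc 0 2) := by
    intro α hα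
    apply ContinuousAt.continuousWithinAt
    have h0 : 0 ≤ α := hα.1
    have c1 : ContinuousAt (fun α : ℝ => Real.Gamma (α / 2 + 1)) α :=
      ContinuousAt.comp (f := fun α : ℝ => α / 2 + 1) (hΓ _ (by linarith)) (by fun_prop)
    have c2 : ContinuousAt (fun α : ℝ => Real.Gamma (((N : ℝ) + α) / 2)) α :=
      ContinuousAt.comp (f := fun α : ℝ => ((N : ℝ) + α) / 2) (hΓ _ (by positivity)) (by fun_prop)
    have c3 : ContinuousAt (fun α : ℝ => (2 : ℝ) ^ (2 - α) * Real.pi ^ (1 + (N : ℝ) / 2)) α :=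
      (continuousAt_const.rpow (by fun_prop) (Or.inl (by norm_num))).mul continuousAt_const
    refine ContinuousAt.div (((continuousAt_const.mul c1).mul c2).mul (by fun_prop)) c3 ?_
    have := Real.pi_pos
    positivity
  obtain ⟨C, hC⟩ := isCompact_Icc.bddAbove_image hf
  refine ⟨C, fun α hα => ?_⟩
  have h1 : normingConst N α = f α := by
    simp only [normingConst, f]
    rw [Real.Gamma_add_one (by have := hα.1; positivity)]
    ring
  rw [h1]
  exact hC (mem_image_of_mem f ⟨hα.1.le, hα.2⟩)

/-- The kernel `2 b(α) (1 - cos ⟨y, ξ⟩) / |y|^(N + α)` of `-D_0^α` acting on `exp (i ⟨·, ξ⟩)`. -/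
noncomputable def levyKernel {N : ℕ} (ξ : Space N) (α : ℝ) (y : Space N) : ℝ :=
  normingConst N α * (2 * (1 - Real.cos (inner ℝ y ξ))) * ‖y‖ ^ (-((N : ℝ) + α))

lemma levyKernel_nonneg {N : ℕ} (ξ : Space N) {α : ℝ} (hα : α ∈ Ioc (0 : ℝ) 2) (y : Space N) :
    0 ≤ levyKernel ξ α y :=
  mul_nonneg (mul_nonneg (normingConst_nonneg N hα)
    (by linarith [Real.cos_le_one (inner ℝ y ξ)])) (by positivity)

/-- The reflection formula Γ(α/2)Γ(1 - α/2) sin(πα/2) = π makes all constants cancel. This fails at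
α = 2, where b vanishes and the kernel with it. -/
lemma lintegral_levyKernel {N : ℕ} (hN : 1 ≤ N) (ξ : Space N) {α : ℝ} (h0 : 0 < α) (h2 : α < 2) :
    ∫⁻ y, ENNReal.ofReal (levyKernel ξ α y) = ENNReal.ofReal (‖ξ‖ ^ α) := by
  have : Nonempty (Fin N) := ⟨⟨0, hN⟩⟩
  have hpi := Real.pi_pos
  have hs : 0 < Real.sin (α * Real.pi / 2) :=
    Real.sin_pos_of_pos_of_lt_pi (by positivity) (by nlinarith [Real.pi_pos])
  have h1 := Real.Gamma_pos_of_pos (show 0 < α / 2 by linarith)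
  have hΓ : Real.Gamma (α / 2) * Real.Gamma (1 - α / 2) * Real.sin (α * Real.pi / 2) = Real.pi := by
    rw [Real.Gamma_mul_Gamma_one_sub, show Real.pi * (α / 2) = α * Real.pi / 2 by ring]
    exact div_mul_cancel₀ _ hs.ne'
  have h3 := Real.Gamma_pos_of_pos (show 0 < ((N : ℝ) + α) / 2 by positivity)
  set c : ℝ := 2 * α * Real.Gamma (α / 2) * Real.sin (α * Real.pi / 2) /
    ((2 : ℝ) ^ (2 - α) * Real.pi ^ (1 + (N : ℝ) / 2)) with hc
  have hc0 : 0 ≤ c := by positivity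
  have key := lintegral_one_sub_cos_mul_rpow (V := Space N) h0 h2 ξ
  simp only [finrank_euclideanSpace_fin] at key
  have e : ∀ y : Space N, ENNReal.ofReal (levyKernel ξ α y) = ENNReal.ofReal c *
      ENNReal.ofReal ((1 - Real.cos (inner ℝ y ξ)) *
        ‖y‖ ^ (-((N : ℝ) + α)) * Real.Gamma (((N : ℝ) + α) / 2)) := by
    intro y
    rw [← ENNReal.ofReal_mul hc0, levyKernel, normingConst, hc]
    congr 1; ring
  simp_rw [e]
  rw [lintegral_const_mul _ (by fun_prop), key, ← ENNReal.ofReal_mul hc0]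
  congr 1
  have e1 : (‖ξ‖ ^ 2 / 4) ^ (α / 2) = ‖ξ‖ ^ α / 2 ^ α := by
    rw [show ‖ξ‖ ^ 2 / 4 = (‖ξ‖ / 2) ^ (2 : ℝ) by rw [Real.rpow_two]; ring,
      ← Real.rpow_mul (by positivity), Real.div_rpow (norm_nonneg _) (by norm_num)]
    ring_nf
  have e2 : (2 : ℝ) ^ (2 - α) = 4 / 2 ^ α := by
    rw [Real.rpow_sub (by norm_num)]; norm_num
  have e3 : Real.pi ^ (1 + (N : ℝ) / 2) = Real.pi * Real.pi ^ ((N : ℝ) / 2) := by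
    rw [Real.rpow_add hpi, Real.rpow_one]
  rw [hc, e1, e2, e3]
  have p1 := Real.rpow_pos_of_pos (show (0 : ℝ) < 2 by norm_num) α
  have p2 := Real.rpow_pos_of_pos hpi ((N : ℝ) / 2)
  field_simp
  calc _ = 4 * ‖ξ‖ ^ α * (Real.Gamma (α / 2) * Real.Gamma (1 - α / 2) * Real.sin (α * Real.pi / 2)) := by
        ring_nf
    _ = _ := by rw [hΓ]; ring

lemma lintegral_one_sub_cos_stdGaussian {N : ℕ} (y : Space N) :
    ∫⁻ ξ, ENNReal.ofReal (1 - Real.cos (inner ℝ y ξ)) ∂(stdGaussian (Space N)) =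
      ENNReal.ofReal (1 - Real.exp (-‖y‖ ^ 2 / 2)) := by
  have h := congrArg Complex.re (charFun_stdGaussian (E := Space N) y)
  rw [charFun_apply, ← RCLike.re_eq_complex_re, ← integral_re] at h
  swap
  · refine (integrable_const (1 : ℝ)).mono' (by fun_prop) (.of_forall fun x => ?_)
    rw [Complex.norm_exp_ofReal_mul_I]
  have e : ∀ x : Space N, RCLike.re (Complex.exp ((inner ℝ x y : ℝ) * Complex.I)) =
      Real.cos (inner ℝ y x) := fun x => by
    rw [RCLike.re_eq_complex_re, Complex.exp_ofReal_mul_I_re, real_inner_comm]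
  simp_rw [e] at h
  have e2 : RCLike.re (Complex.exp (-(‖y‖ : ℂ) ^ 2 / 2)) = Real.exp (-‖y‖ ^ 2 / 2) := by
    rw [RCLike.re_eq_complex_re, ← Complex.ofReal_re (Real.exp _)]
    push_cast; rfl
  rw [e2] at h
  have hi : Integrable (fun ξ => Real.cos (inner ℝ y ξ)) (stdGaussian (Space N)) :=
    (integrable_const (1 : ℝ)).mono' (by fun_prop) (.of_forall fun x => Real.abs_cos_le_one _)
  have h3 := ofReal_integral_eq_lintegral_ofReal ((integrable_const (1 : ℝ)).sub hi)
    (.of_forall fun x => by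
      simp only [Pi.zero_apply, Pi.sub_apply]; linarith [Real.cos_le_one (inner ℝ y x)])
  simp only [Pi.sub_apply] at h3
  rw [← h, ← h3, integral_sub (integrable_const _) hi]
  simp

/-- A majorant, up to a constant, of `levyKernel ξ α`. -/
noncomputable def levyMajorant {N : ℕ} (α : ℝ) (y : Space N) : ℝ :=
  normingConst N α * (2 * (1 - Real.exp (-‖y‖ ^ 2 / 2))) * ‖y‖ ^ (-((N : ℝ) + α))

/-- The majorant is the average of `levyKernel ξ α` over a standard Gaussian ξ, so Tonelli reduces
its integral to the known one. -/
lemma lintegral_levyMajorant {N : ℕ} (hN : 1 ≤ N) {α : ℝ} (h0 : 0 < α) (h2 : α < 2) :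
    ∫⁻ y : Space N, ENNReal.ofReal (levyMajorant α y) =
      ∫⁻ ξ, ENNReal.ofReal (‖ξ‖ ^ α) ∂(stdGaussian (Space N)) := by
  have hb := normingConst_nonneg N (α := α) ⟨h0, h2.le⟩
  have e : ∀ y : Space N, ENNReal.ofReal (levyMajorant α y) =
      ∫⁻ ξ, ENNReal.ofReal (levyKernel ξ α y) ∂(stdGaussian (Space N)) := by
    intro y
    have hc : 0 ≤ normingConst N α * 2 * ‖y‖ ^ (-((N : ℝ) + α)) := by positivity
    have e1 : levyMajorant α y =
        normingConst N α * 2 * ‖y‖ ^ (-((N : ℝ) + α)) * (1 - Real.exp (-‖y‖ ^ 2 / 2)) := by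
      rw [levyMajorant]; ring
    have e2 : ∀ ξ, levyKernel ξ α y =
        normingConst N α * 2 * ‖y‖ ^ (-((N : ℝ) + α)) * (1 - Real.cos (inner ℝ y ξ)) := by
      intro ξ; rw [levyKernel]; ring
    simp_rw [e1, e2, ENNReal.ofReal_mul hc]
    rw [lintegral_const_mul _ (by fun_prop), lintegral_one_sub_cos_stdGaussian]
  simp_rw [e]
  rw [lintegral_lintegral_swap]
  · simp_rw [lintegral_levyKernel hN _ h0 h2]
  · refine Measurable.aemeasurable ?_
    simp only [Function.uncurry_def, levyKernel]
    fun_prop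

lemma rpow_le_one_add_sq {x α : ℝ} (hx : 0 ≤ x) (hα : α ∈ Ioc (0 : ℝ) 2) : x ^ α ≤ 1 + x ^ 2 := by
  rcases le_total x 1 with h | h
  · have := Real.rpow_le_one hx h hα.1.le
    nlinarith [sq_nonneg x]
  · have := Real.rpow_le_rpow_of_exponent_le h hα.2
    rw [Real.rpow_two] at this
    linarith

/-- The Gaussian moment E|ξ|^α is at most E(1 + |ξ|²) for all α at once; the outer limit, in α,
needs this uniformity. -/
lemma exists_lintegral_levyMajorant_le {N : ℕ} (hN : 1 ≤ N) :
    ∃ C : ENNReal, C ≠ ⊤ ∧ ∀ α : ℝ, 0 < α → α < 2 →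
      ∫⁻ y : Space N, ENNReal.ofReal (levyMajorant α y) ≤ C := by
  refine ⟨∫⁻ ξ, ENNReal.ofReal (1 + ‖ξ‖ ^ 2) ∂(stdGaussian (Space N)), ?_, fun α h0 h2 => ?_⟩
  · have hi : Integrable (fun ξ => 1 + ‖ξ‖ ^ 2) (stdGaussian (Space N)) := by
      refine (integrable_const _).add ?_
      exact (IsGaussian.memLp_two_id (μ := stdGaussian (Space N))).integrable_norm_pow (by norm_num)
    rw [← ofReal_integral_eq_lintegral_ofReal hi (.of_forall fun _ => by
      simp only [Pi.zero_apply]; positivity)]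
    exact ENNReal.ofReal_ne_top
  · rw [lintegral_levyMajorant hN h0 h2]
    exact lintegral_mono fun ξ =>
      ENNReal.ofReal_le_ofReal (rpow_le_one_add_sq (norm_nonneg _) ⟨h0, h2.le⟩)

end LevyKernel

/-! ### Lattice sums as integrals of step functions, and their limit. -/

section RiemannSum

/-- The index of the cell of the lattice `(hℤ)^N` containing `y`. -/
noncomputable def cellIndex {N : ℕ} (h : ℝ) (y : Space N) : Fin N → ℤ := fun i => round (y i / h)

/-- The centre of the cell of the lattice `(hℤ)^N` containing `y`. -/
noncomputable def cellCenter {N : ℕ} (h : ℝ) (y : Space N) : Space N := node h (cellIndex h y)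

lemma measurable_cellIndex {N : ℕ} (h : ℝ) : Measurable (cellIndex (N := N) h) := by
  refine measurable_pi_iff.2 fun i => ?_
  simp only [cellIndex, round_eq]
  exact Int.measurable_floor.comp (by fun_prop)

lemma measurable_cellCenter {N : ℕ} (h : ℝ) : Measurable (cellCenter (N := N) h) :=
  (measurable_of_countable (node h)).comp (measurable_cellIndex h)

lemma volume_cellIndex_preimage {N : ℕ} {h : ℝ} (hh : 0 < h) (k : Fin N → ℤ) :
    volume (cellIndex h ⁻¹' {k}) = ENNReal.ofReal h ^ N := by
  have e : cellIndex h ⁻¹' {k} = (WithLp.ofLp : Space N → Fin N → ℝ) ⁻¹'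
      (Set.pi univ fun i => Ico (h * (k i - 1 / 2)) (h * (k i + 1 / 2))) := by
    ext y
    simp only [mem_preimage, mem_singleton_iff, Set.mem_pi, mem_univ, true_implies, mem_Ico,
      funext_iff, cellIndex, round_eq, Int.floor_eq_iff]
    refine forall_congr' fun i => ?_
    rw [show y i / h + 1 / 2 = (y i + h / 2) / h by field_simp, le_div_iff₀ hh, div_lt_iff₀ hh]
    constructor <;> rintro ⟨h1, h2⟩ <;> constructor <;> linarith
  rw [e, (PiLp.volume_preserving_ofLp (Fin N)).measure_preimage
    (MeasurableSet.univ_pi fun i => measurableSet_Ico).nullMeasurableSet, Real.volume_pi_Ico]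
  have : ∀ i, h * ((k i : ℝ) + 1 / 2) - h * (k i - 1 / 2) = h := fun i => by ring
  simp only [this, Finset.prod_const, Finset.card_univ, Fintype.card_fin]

lemma lintegral_comp_cellIndex {N : ℕ} {h : ℝ} (hh : 0 < h) (f : (Fin N → ℤ) → ENNReal) :
    ∫⁻ y : Space N, f (cellIndex h y) = ∑' k, f k * ENNReal.ofReal h ^ N := by
  rw [← lintegral_map (measurable_of_countable f) (measurable_cellIndex h), lintegral_countable']
  refine tsum_congr fun k => ?_
  rw [Measure.map_apply (measurable_cellIndex h) (measurableSet_singleton k),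
    volume_cellIndex_preimage hh]

lemma cellCenter_apply {N : ℕ} (h : ℝ) (y : Space N) (i : Fin N) :
    cellCenter h y i = h * round (y i / h) := rfl

lemma abs_sub_cellCenter_le {N : ℕ} {h : ℝ} (hh : 0 < h) (y : Space N) (i : Fin N) :
    |y i - cellCenter h y i| ≤ h / 2 := by
  have h1 := abs_sub_round (y i / h)
  have h2 : y i - cellCenter h y i = h * (y i / h - round (y i / h)) := by
    rw [cellCenter_apply]; field_simp
  rw [h2, abs_mul, abs_of_pos hh]
  nlinarith

lemma norm_sub_cellCenter_le {N : ℕ} {h : ℝ} (hh : 0 < h) (y : Space N) :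
    ‖y - cellCenter h y‖ ≤ N * h := by
  have h1 : ‖y - cellCenter h y‖ ^ 2 ≤ (N * h) ^ 2 := by
    rw [EuclideanSpace.norm_sq_eq]
    calc ∑ i, ‖(y - cellCenter h y) i‖ ^ 2 ≤ ∑ _i : Fin N, (h / 2) ^ 2 := by
          refine Finset.sum_le_sum fun i _ => ?_
          exact pow_le_pow_left₀ (norm_nonneg _) (abs_sub_cellCenter_le hh y i) 2
      _ = N * (h / 2) ^ 2 := by simp
      _ ≤ (N * h) ^ 2 := by
          rcases Nat.eq_zero_or_pos N with rfl | hN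
          · simp
          have : (1 : ℝ) ≤ N := by exact_mod_cast hN
          nlinarith [sq_nonneg h, mul_nonneg (sub_nonneg.2 this) (sq_nonneg h),
            mul_nonneg (mul_nonneg (sub_nonneg.2 this) (Nat.cast_nonneg (α := ℝ) N)) (sq_nonneg h)]
  exact (pow_le_pow_iff_left₀ (norm_nonneg _) (by positivity) two_ne_zero).1 h1

/-- Coordinatewise, a nonzero rounded value is at least h in absolute value, so the rounding error
h/2 is at most half of it. -/
lemma norm_cellCenter_le {N : ℕ} {h : ℝ} (hh : 0 < h) (y : Space N) :
    ‖cellCenter h y‖ ≤ 2 * ‖y‖ := by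
  have h1 : ‖cellCenter h y‖ ^ 2 ≤ (2 * ‖y‖) ^ 2 := by
    rw [mul_pow, EuclideanSpace.norm_sq_eq, EuclideanSpace.norm_sq_eq, Finset.mul_sum]
    refine Finset.sum_le_sum fun i _ => ?_
    rw [← mul_pow]
    refine pow_le_pow_left₀ (norm_nonneg _) ?_ 2
    rw [Real.norm_eq_abs, Real.norm_eq_abs]
    have h2 := abs_sub_cellCenter_le hh y i
    by_cases hk : round (y i / h) = 0
    · rw [cellCenter_apply, hk]; simp
    · have h3 : h ≤ |cellCenter h y i| := by
        rw [cellCenter_apply, abs_mul, abs_of_pos hh]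
        have : (1 : ℝ) ≤ |(round (y i / h) : ℝ)| := by exact_mod_cast Int.one_le_abs hk
        nlinarith
      have h4 := abs_sub_abs_le_abs_sub (cellCenter h y i) (y i)
      rw [abs_sub_comm] at h4
      linarith
  exact (pow_le_pow_iff_left₀ (norm_nonneg _) (by positivity) two_ne_zero).1 h1

lemma norm_le_norm_cellCenter {N : ℕ} {h : ℝ} (hh : 0 < h) {y : Space N}
    (hz : cellCenter h y ≠ 0) : ‖y‖ ≤ (1 + N) * ‖cellCenter h y‖ := by
  obtain ⟨i, hi⟩ : ∃ i, cellCenter h y i ≠ 0 := by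
    by_contra! hn
    exact hz (PiLp.ext hn)
  have h3 : h ≤ |cellCenter h y i| := by
    have hk : round (y i / h) ≠ 0 := fun h0 => hi (by rw [cellCenter_apply, h0]; simp)
    rw [cellCenter_apply, abs_mul, abs_of_pos hh]
    have : (1 : ℝ) ≤ |(round (y i / h) : ℝ)| := by exact_mod_cast Int.one_le_abs hk
    nlinarith
  have h4 : |cellCenter h y i| ≤ ‖cellCenter h y‖ := PiLp.norm_apply_le (cellCenter h y) i
  have h5 := norm_sub_cellCenter_le hh y
  have h6 : ‖y‖ ≤ ‖y - cellCenter h y‖ + ‖cellCenter h y‖ := by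
    simpa using norm_add_le (y - cellCenter h y) (cellCenter h y)
  have : (N : ℝ) * h ≤ N * ‖cellCenter h y‖ := by gcongr; linarith
  linarith

/-- With x = |y|²/2, the left side is at most 4|ξ|²x and at most 2, hence at most (4|ξ|² + 2) x/(1 +
x), and x/(1 + x) ≤ 1 - e^{-x}. -/
lemma one_sub_cos_inner_le {V : Type*} [NormedAddCommGroup V] [InnerProductSpace ℝ V] {y z : V}
    (hz : ‖z‖ ≤ 2 * ‖y‖) (ξ : V) :
    1 - Real.cos (inner ℝ z ξ) ≤ (4 * ‖ξ‖ ^ 2 + 2) * (1 - Real.exp (-‖y‖ ^ 2 / 2)) := by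
  set x := ‖y‖ ^ 2 / 2 with hx
  have hx0 : 0 ≤ x := by positivity
  have h1 : Real.exp (-‖y‖ ^ 2 / 2) ≤ 1 / (1 + x) := by
    rw [neg_div, ← hx, Real.exp_neg, ← one_div]
    exact one_div_le_one_div_of_le (by linarith) (by linarith [Real.add_one_le_exp x])
  have h2 : x / (1 + x) ≤ 1 - Real.exp (-‖y‖ ^ 2 / 2) := by
    have : x / (1 + x) = 1 - 1 / (1 + x) := by field_simp; ring
    linarith
  have h3 : 1 - Real.cos (inner ℝ z ξ) ≤ 4 * ‖ξ‖ ^ 2 * x := by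
    have h4 := Real.one_sub_sq_div_two_le_cos (x := inner ℝ z ξ)
    have h5 : (inner ℝ z ξ : ℝ) ^ 2 ≤ (2 * ‖y‖ * ‖ξ‖) ^ 2 := by
      rw [← sq_abs]
      refine pow_le_pow_left₀ (abs_nonneg _) ?_ 2
      exact (abs_real_inner_le_norm z ξ).trans (by gcongr)
    have : (2 * ‖y‖ * ‖ξ‖) ^ 2 = 8 * ‖ξ‖ ^ 2 * x := by rw [hx]; ring
    linarith
  have h4 : 1 - Real.cos (inner ℝ z ξ) ≤ 2 := by linarith [Real.neg_one_le_cos (inner ℝ z ξ)]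
  have h6 : 1 - Real.cos (inner ℝ z ξ) ≤ (4 * ‖ξ‖ ^ 2 + 2) * (x / (1 + x)) := by
    rw [← mul_div_assoc, le_div_iff₀ (by linarith)]
    nlinarith
  exact h6.trans (mul_le_mul_of_nonneg_left h2 (by positivity))

lemma levyMajorant_nonneg {N : ℕ} {α : ℝ} (hα : α ∈ Ioc (0 : ℝ) 2) (y : Space N) :
    0 ≤ levyMajorant α y := by
  refine mul_nonneg (mul_nonneg (normingConst_nonneg N hα) ?_) (by positivity)
  have : Real.exp (-‖y‖ ^ 2 / 2) ≤ 1 :=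
    Real.exp_le_one_iff.2 (by have := sq_nonneg ‖y‖; linarith)
  linarith

/-- On the central cell the sampled kernel is 0, which removes the singularity at the origin.
Elsewhere |y| and the norm of the centre are comparable with constants free of h. -/
lemma levyKernel_cellCenter_le {N : ℕ} (ξ : Space N) {α h : ℝ} (hα : α ∈ Ioc (0 : ℝ) 2)
    (hh : 0 < h) (y : Space N) :
    levyKernel ξ α (cellCenter h y) ≤
      (4 * ‖ξ‖ ^ 2 + 2) * (1 + N) ^ (N + 2) * levyMajorant α y := by
  by_cases hz : cellCenter h y = 0
  · rw [hz]
    have := levyMajorant_nonneg hα y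
    simp only [levyKernel, inner_zero_left, Real.cos_zero, sub_self, mul_zero, zero_mul]
    positivity
  have hα0 := hα.1
  have hzy := norm_cellCenter_le hh y
  have hyz := norm_le_norm_cellCenter hh hz
  have hz0 : 0 < ‖cellCenter h y‖ := norm_pos_iff.2 hz
  have hy0 : 0 < ‖y‖ := by linarith
  have hM : (1 : ℝ) ≤ 1 + N := by have : (0 : ℝ) ≤ N := Nat.cast_nonneg N; linarith
  have h1 : ‖cellCenter h y‖ ^ (-((N : ℝ) + α)) ≤
      (1 + (N : ℝ)) ^ (N + 2) * ‖y‖ ^ (-((N : ℝ) + α)) := by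
    have h2 : ‖y‖ / (1 + N) ≤ ‖cellCenter h y‖ := by
      rw [div_le_iff₀ (by linarith)]; linarith
    calc ‖cellCenter h y‖ ^ (-((N : ℝ) + α)) ≤ (‖y‖ / (1 + N)) ^ (-((N : ℝ) + α)) :=
          Real.rpow_le_rpow_of_nonpos (by positivity) h2
            (by have : (0 : ℝ) ≤ N := Nat.cast_nonneg N; linarith)
      _ = (1 + (N : ℝ)) ^ ((N : ℝ) + α) * ‖y‖ ^ (-((N : ℝ) + α)) := by
          rw [Real.div_rpow hy0.le (by linarith), Real.rpow_neg (by linarith : (0 : ℝ) ≤ 1 + N)]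
          field_simp
      _ ≤ (1 + (N : ℝ)) ^ (N + 2) * ‖y‖ ^ (-((N : ℝ) + α)) := by
          -- Replacing the exponent N + α by N + 2 makes the constant independent of α.
          gcongr
          rw [← Real.rpow_natCast]
          apply Real.rpow_le_rpow_of_exponent_le hM
          push_cast
          linarith [hα.2]
  have h2 := one_sub_cos_inner_le hzy ξ
  have hb := normingConst_nonneg N hα
  have h3 : 0 ≤ 1 - Real.exp (-‖y‖ ^ 2 / 2) := by
    have : Real.exp (-‖y‖ ^ 2 / 2) ≤ 1 :=
      Real.exp_le_one_iff.2 (by have := sq_nonneg ‖y‖; linarith)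
    linarith
  calc levyKernel ξ α (cellCenter h y) ≤ normingConst N α *
        (2 * ((4 * ‖ξ‖ ^ 2 + 2) * (1 - Real.exp (-‖y‖ ^ 2 / 2)))) *
          ((1 + (N : ℝ)) ^ (N + 2) * ‖y‖ ^ (-((N : ℝ) + α))) := by
        rw [levyKernel]; gcongr
    _ = _ := by rw [levyMajorant]; ring

/-- The exponent `∑_{m ≠ 0} 2 Q_m(h) |m|^(-N) (1 - cos ⟨h m, ξ⟩)` of the walk, as an integral. -/
noncomputable def latticeExponent {N : ℕ} (a : Measure ℝ) (h : ℝ) (ξ : Space N) : ENNReal :=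
  ∫⁻ α in Ioc 0 2, (∫⁻ y, ENNReal.ofReal (levyKernel ξ α (cellCenter h y))) ∂a

lemma tendsto_lintegral_levyKernel {N : ℕ} (hN : 1 ≤ N) (ξ : Space N) {α : ℝ} (h0 : 0 < α)
    (h2 : α < 2) {h : ℕ → ℝ} (h_pos : ∀ n, 0 < h n) (h_lim : Tendsto h atTop (𝓝 0)) :
    Tendsto (fun n => ∫⁻ y, ENNReal.ofReal (levyKernel ξ α (cellCenter (h n) y))) atTop
      (𝓝 (ENNReal.ofReal (‖ξ‖ ^ α))) := by
  have hα : α ∈ Ioc (0 : ℝ) 2 := ⟨h0, h2.le⟩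
  have : Nonempty (Fin N) := ⟨⟨0, hN⟩⟩
  obtain ⟨C, hC, hCle⟩ := exists_lintegral_levyMajorant_le hN
  rw [← lintegral_levyKernel hN ξ h0 h2]
  refine tendsto_lintegral_of_dominated_convergence (fun y => ENNReal.ofReal
    ((4 * ‖ξ‖ ^ 2 + 2) * (1 + N) ^ (N + 2) * levyMajorant α y)) (fun n => ?_)
    (fun n => .of_forall fun y => ENNReal.ofReal_le_ofReal
      (levyKernel_cellCenter_le ξ hα (h_pos n) y)) ?_ ?_
  · have := measurable_cellCenter (N := N) (h n)
    unfold levyKernel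
    fun_prop
  · simp_rw [ENNReal.ofReal_mul (show 0 ≤ (4 * ‖ξ‖ ^ 2 + 2) * (1 + (N : ℝ)) ^ (N + 2) by positivity)]
    rw [lintegral_const_mul _ (by unfold levyMajorant; fun_prop)]
    exact ENNReal.mul_ne_top ENNReal.ofReal_ne_top (ne_top_of_le_ne_top hC (hCle α h0 h2))
  · have : ∀ᵐ y : Space N, y ≠ 0 := by
      rw [ae_iff]; simp
    filter_upwards [this] with y hy
    have hlim : Tendsto (fun n => cellCenter (h n) y) atTop (𝓝 y) := by
      rw [tendsto_iff_norm_sub_tendsto_zero]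
      refine squeeze_zero (fun _ => norm_nonneg _) (fun n => ?_)
        (by simpa using h_lim.const_mul (N : ℝ))
      rw [norm_sub_rev]
      exact norm_sub_cellCenter_le (h_pos n) y
    have hc : ContinuousAt (levyKernel ξ α) y := by
      unfold levyKernel
      refine ContinuousAt.mul (by fun_prop) ?_
      exact continuous_norm.continuousAt.rpow_const (Or.inl (norm_ne_zero_iff.2 hy))
    exact (ENNReal.continuous_ofReal.tendsto _).comp (hc.tendsto.comp hlim)

lemma aemeasurable_normingConst (N : ℕ) (a : Measure ℝ) :
    AEMeasurable (normingConst N) (a.restrict (Ioc 0 2)) :=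
  (continuousOn_normingConst N).aemeasurable measurableSet_Ioc

lemma integrableOn_norm_rpow {N : ℕ} (a : Measure ℝ) [IsFiniteMeasure a] (ξ : Space N) :
    IntegrableOn (fun α : ℝ => ‖ξ‖ ^ α) (Ioc 0 2) a := by
  refine (integrable_const (1 + ‖ξ‖ ^ 2)).mono' (by fun_prop) ?_
  filter_upwards [self_mem_ae_restrict measurableSet_Ioc] with α hα
  rw [Real.norm_of_nonneg (by positivity)]
  exact rpow_le_one_add_sq (norm_nonneg _) hα

/-- At α = 2 the walk sees nothing, since b(2) = 0, while the symbol has |ξ|²; an atom there would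
spoil the limit. -/
lemma ae_mem_Ioo {a : Measure ℝ} (ha_two : a {2} = 0) :
    ∀ᵐ α ∂(a.restrict (Ioc 0 2)), α ∈ Ioo (0 : ℝ) 2 := by
  have : ∀ᵐ α ∂(a.restrict (Ioc 0 2)), α ≠ 2 :=
    ae_restrict_of_ae (by rw [ae_iff]; simpa using ha_two)
  filter_upwards [self_mem_ae_restrict measurableSet_Ioc, this] with α h1 h2
  exact ⟨h1.1, lt_of_le_of_ne h1.2 h2⟩

lemma aemeasurable_levyKernel_cellCenter {N : ℕ} (a : Measure ℝ) [IsFiniteMeasure a] (h : ℝ)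
    (ξ : Space N) :
    AEMeasurable (fun p : ℝ × Space N => ENNReal.ofReal (levyKernel ξ p.1 (cellCenter h p.2)))
      ((a.restrict (Ioc 0 2)).prod volume) := by
  have h1 : AEMeasurable (fun p : ℝ × Space N => normingConst N p.1)
      ((a.restrict (Ioc 0 2)).prod volume) := (aemeasurable_normingConst N a).comp_fst
  have h2 := measurable_cellCenter (N := N) h
  unfold levyKernel
  refine ((h1.mul ?_).mul ?_).ennreal_ofReal
  · exact Measurable.aemeasurable (by fun_prop)
  · exact Measurable.aemeasurable (by fun_prop)

lemma tendsto_latticeExponent {N : ℕ} (hN : 1 ≤ N) (a : Measure ℝ) [IsFiniteMeasure a]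
    (ha_two : a {2} = 0) (ξ : Space N) {h : ℕ → ℝ} (h_pos : ∀ n, 0 < h n)
    (h_lim : Tendsto h atTop (𝓝 0)) :
    Tendsto (fun n => latticeExponent a (h n) ξ) atTop (𝓝 (ENNReal.ofReal (-symbol a ξ))) := by
  obtain ⟨C, hC, hCle⟩ := exists_lintegral_levyMajorant_le hN
  have hlim : ENNReal.ofReal (-symbol a ξ) = ∫⁻ α in Ioc 0 2, ENNReal.ofReal (‖ξ‖ ^ α) ∂a := by
    rw [symbol, neg_neg, ofReal_integral_eq_lintegral_ofReal (integrableOn_norm_rpow a ξ)]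
    exact .of_forall fun α => by simp only [Pi.zero_apply]; positivity
  rw [hlim]
  set K : ENNReal := ENNReal.ofReal ((4 * ‖ξ‖ ^ 2 + 2) * (1 + (N : ℝ)) ^ (N + 2))
  refine tendsto_lintegral_of_dominated_convergence' (fun _ => K * C) (fun n => ?_) (fun n => ?_)
    ?_ ?_
  · exact (aemeasurable_levyKernel_cellCenter a (h n) ξ).lintegral_prod_right'
  · filter_upwards [ae_mem_Ioo ha_two] with α hα
    calc _ ≤ ∫⁻ y, K * ENNReal.ofReal (levyMajorant (N := N) α y) := by
          refine lintegral_mono fun y => ?_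
          rw [← ENNReal.ofReal_mul (by positivity)]
          exact ENNReal.ofReal_le_ofReal
            (levyKernel_cellCenter_le ξ ⟨hα.1, hα.2.le⟩ (h_pos n) y)
      _ = K * ∫⁻ y, ENNReal.ofReal (levyMajorant (N := N) α y) :=
          lintegral_const_mul _ (by unfold levyMajorant; fun_prop)
      _ ≤ K * C := by gcongr; exact hCle α hα.1 hα.2
  · rw [lintegral_const]
    exact ENNReal.mul_ne_top (ENNReal.mul_ne_top ENNReal.ofReal_ne_top hC) (measure_ne_top _ _)
  · filter_upwards [ae_mem_Ioo ha_two] with α hα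
    exact tendsto_lintegral_levyKernel hN ξ hα.1 hα.2 h_pos h_lim

end RiemannSum

/-! ### The characteristic function of one step. -/

section Step

lemma node_eq_smul {N : ℕ} (h : ℝ) (k : Fin N → ℤ) : node h k = h • node 1 k := by
  ext i; simp [node]

lemma node_zero {N : ℕ} (h : ℝ) : node h (0 : Fin N → ℤ) = 0 := by
  ext i; simp [node]

lemma node_neg {N : ℕ} (h : ℝ) (k : Fin N → ℤ) : node h (-k) = -node h k := by
  ext i; simp [node]

lemma latticeNorm_pos {N : ℕ} {k : Fin N → ℤ} (hk : k ≠ 0) : 0 < latticeNorm k := by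
  refine norm_pos_iff.2 fun h0 => hk ?_
  ext i
  have := congrArg (fun z : Space N => z i) h0
  simpa [node] using this

lemma norm_node {N : ℕ} {h : ℝ} (hh : 0 < h) (k : Fin N → ℤ) :
    ‖node h k‖ = h * latticeNorm k := by
  rw [node_eq_smul, norm_smul, Real.norm_of_nonneg hh.le, latticeNorm]

lemma transitionProb_neg {N : ℕ} (a : Measure ℝ) (τ h : ℝ) (k : Fin N → ℤ) :
    transitionProb a τ h (-k) = transitionProb a τ h k := by
  have e : latticeNorm (-k) = latticeNorm k := by
    rw [latticeNorm, node_neg, norm_neg, latticeNorm]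
  simp only [transitionProb, neg_eq_zero, Q, e]

lemma integrableOn_Q {N : ℕ} (hN : 1 ≤ N) (a : Measure ℝ) [IsFiniteMeasure a] {h : ℝ}
    (hh : 0 < h) {k : Fin N → ℤ} (hk : k ≠ 0) :
    IntegrableOn (fun α => latticeNorm k ^ (-α) * (normingConst N α / h ^ α)) (Ioc 0 2) a := by
  obtain ⟨C, hC⟩ := exists_normingConst_le N hN
  have hk0 := latticeNorm_pos hk
  set x := (latticeNorm k * h)⁻¹ with hx
  have hx0 : 0 ≤ x := by positivity
  refine (integrable_const ((1 + x ^ 2) * C)).mono' ?_ ?_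
  · have h1 := aemeasurable_normingConst N a
    refine AEMeasurable.aestronglyMeasurable ?_
    exact AEMeasurable.mul (Measurable.aemeasurable (by fun_prop))
      (h1.div (Measurable.aemeasurable (by fun_prop)))
  · filter_upwards [self_mem_ae_restrict measurableSet_Ioc] with α hα
    have hb := normingConst_nonneg N hα
    have e : latticeNorm k ^ (-α) * (normingConst N α / h ^ α) = x ^ α * normingConst N α := by
      rw [hx, Real.inv_rpow (by positivity), Real.mul_rpow hk0.le hh.le, Real.rpow_neg hk0.le]
      field_simp
    rw [e, Real.norm_of_nonneg (by positivity)]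
    exact mul_le_mul (rpow_le_one_add_sq hx0 hα) (hC α hα) hb (by positivity)

/-- Scaling: h^N |hk|^(-N-α) = |k|^(-N) |k|^(-α) h^(-α). At k = 0 both sides vanish, whatever the
probability of staying put. -/
lemma ofReal_mul_transitionProb {N : ℕ} (hN : 1 ≤ N) (a : Measure ℝ) [IsFiniteMeasure a]
    {τ h : ℝ} (hτ : 0 < τ) (hh : 0 < h) (ξ : Space N) (k : Fin N → ℤ) :
    ENNReal.ofReal (1 - Real.cos (inner ℝ (node h k) ξ)) *
        ENNReal.ofReal (transitionProb a τ h k) =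
      ENNReal.ofReal τ * ∫⁻ α in Ioc 0 2,
        ENNReal.ofReal (levyKernel ξ α (node h k)) * ENNReal.ofReal h ^ N ∂a := by
  have hc : 0 ≤ 1 - Real.cos (inner ℝ (node h k) ξ) := by
    linarith [Real.cos_le_one (inner ℝ (node h k) ξ)]
  by_cases hk : k = 0
  · subst hk
    simp [node_zero, levyKernel]
  have hk0 := latticeNorm_pos hk
  rw [transitionProb, if_neg hk, Q, ← ENNReal.ofReal_mul hc,
    show ∀ c q : ℝ, c * (2 * τ * (q / latticeNorm k ^ N)) = (c * 2 * τ / latticeNorm k ^ N) * q by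
      intro c q; ring,
    ENNReal.ofReal_mul (by positivity), ofReal_integral_eq_lintegral_ofReal
      (integrableOn_Q hN a hh hk), ← lintegral_const_mul' _ _ ENNReal.ofReal_ne_top,
    ← lintegral_const_mul' _ _ ENNReal.ofReal_ne_top]
  · apply setLIntegral_congr_fun measurableSet_Ioc
    intro α hα
    have hb := normingConst_nonneg N hα
    simp only
    rw [← ENNReal.ofReal_pow hh.le, ← ENNReal.ofReal_mul (by positivity),
      ← ENNReal.ofReal_mul (levyKernel_nonneg ξ hα _), ← ENNReal.ofReal_mul hτ.le]
    congr 1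
    rw [levyKernel, norm_node hh, Real.mul_rpow hh.le hk0.le, Real.rpow_neg hh.le,
      Real.rpow_neg hk0.le, Real.rpow_neg hk0.le, Real.rpow_add hh, Real.rpow_add hk0,
      Real.rpow_natCast, Real.rpow_natCast]
    have := (Real.rpow_pos_of_pos hh α).ne'
    have := (Real.rpow_pos_of_pos hk0 α).ne'
    field_simp
  · filter_upwards [self_mem_ae_restrict measurableSet_Ioc] with α hα
    have hb := normingConst_nonneg N hα
    simp only [Pi.zero_apply]; positivity

lemma lintegral_one_sub_cos_step {N : ℕ} (hN : 1 ≤ N) (a : Measure ℝ) [IsFiniteMeasure a]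
    {τ h : ℝ} (hτ : 0 < τ) (hh : 0 < h) {ν : Measure (Fin N → ℤ)} [IsProbabilityMeasure ν]
    (hν : ∀ k, ν.real {k} = transitionProb a τ h k) (ξ : Space N) :
    ∫⁻ k, ENNReal.ofReal (1 - Real.cos (inner ℝ (node h k) ξ)) ∂ν =
      ENNReal.ofReal τ * latticeExponent a h ξ := by
  have hν' : ∀ k, ν {k} = ENNReal.ofReal (transitionProb a τ h k) := fun k => by
    rw [← hν, ofReal_measureReal]
  rw [lintegral_countable']
  simp_rw [hν', ofReal_mul_transitionProb hN a hτ hh, ENNReal.tsum_mul_left]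
  rw [← lintegral_tsum, latticeExponent]
  · congr 1
    refine lintegral_congr fun α => ?_
    exact (lintegral_comp_cellIndex hh (fun k => ENNReal.ofReal (levyKernel ξ α (node h k)))).symm
  · intro k
    have h1 := aemeasurable_normingConst N a
    unfold levyKernel
    refine AEMeasurable.mul_const (AEMeasurable.ennreal_ofReal ?_) _
    exact (h1.mul_const _).mul (Measurable.aemeasurable (by fun_prop))

/-- Symmetry of the step, which kills the sine part of its characteristic function. -/
lemma map_neg_of_transitionProb {N : ℕ} {a : Measure ℝ} {τ h : ℝ} {ν : Measure (Fin N → ℤ)}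
    [IsProbabilityMeasure ν] (hν : ∀ k, ν.real {k} = transitionProb a τ h k) :
    ν.map (fun k => -k) = ν := by
  refine Measure.ext_of_singleton fun k => ?_
  rw [Measure.map_apply (measurable_of_countable _) (measurableSet_singleton k)]
  have : (fun k : Fin N → ℤ => -k) ⁻¹' {k} = {-k} := by
    ext m; simp
  rw [this, ← ofReal_measureReal, ← ofReal_measureReal, hν, hν, transitionProb_neg]

lemma charFun_map_node {N : ℕ} (hN : 1 ≤ N) (a : Measure ℝ) [IsFiniteMeasure a]
    {τ h : ℝ} (hτ : 0 < τ) (hh : 0 < h) {ν : Measure (Fin N → ℤ)} [IsProbabilityMeasure ν]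
    (hν : ∀ k, ν.real {k} = transitionProb a τ h k) (ξ : Space N) :
    charFun (ν.map (node h)) ξ = ((1 - τ * (latticeExponent a h ξ).toReal : ℝ) : ℂ) := by
  have hm : Measurable (node h : (Fin N → ℤ) → Space N) := measurable_of_countable _
  rw [charFun_apply, integral_map hm.aemeasurable (by fun_prop)]
  have hi : Integrable (fun k => Complex.exp ((inner ℝ (node h k) ξ : ℝ) * Complex.I)) ν := by
    refine (integrable_const (1 : ℝ)).mono' (measurable_of_countable _).aestronglyMeasurable
      (.of_forall fun x => ?_)
    rw [Complex.norm_exp_ofReal_mul_I]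
  apply Complex.ext
  · rw [← RCLike.re_eq_complex_re, ← integral_re hi]
    simp only [RCLike.re_eq_complex_re, Complex.exp_ofReal_mul_I_re, Complex.ofReal_re]
    have hc : Integrable (fun k => Real.cos (inner ℝ (node h k) ξ)) ν := by
      simpa using hi.re
    have h1 : ∫ k, (1 - Real.cos (inner ℝ (node h k) ξ)) ∂ν =
        τ * (latticeExponent a h ξ).toReal := by
      rw [integral_eq_lintegral_of_nonneg_ae _ (measurable_of_countable _).aestronglyMeasurable,
        lintegral_one_sub_cos_step hN a hτ hh hν, ENNReal.toReal_mul, ENNReal.toReal_ofReal hτ.le]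
      exact .of_forall fun k => by
        simp only [Pi.zero_apply]; linarith [Real.cos_le_one (inner ℝ (node h k) ξ)]
    rw [integral_sub (integrable_const _) hc] at h1
    simp only [integral_const, probReal_univ, smul_eq_mul, mul_one] at h1
    linarith
  · rw [← RCLike.im_eq_complex_im, ← integral_im hi]
    simp only [RCLike.im_eq_complex_im, Complex.exp_ofReal_mul_I_im, Complex.ofReal_im]
    have h1 : ∫ k, Real.sin (inner ℝ (node h k) ξ) ∂ν =
        -∫ k, Real.sin (inner ℝ (node h k) ξ) ∂ν := by
      conv_lhs => rw [← map_neg_of_transitionProb hν]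
      rw [integral_map (measurable_of_countable _).aemeasurable
        (measurable_of_countable _).aestronglyMeasurable, ← integral_neg]
      simp only [node_neg, inner_neg_left, Real.sin_neg]
    linarith

end Step

/-! ### Translation to Mathlib's Fourier transform, and Parseval. -/

section FourierConventions

open scoped FourierTransform

variable {N : ℕ}

lemma fourierF_two_pi_smul (f : Space N → ℂ) (η : Space N) :
    fourierF f ((2 * Real.pi) • η) = 𝓕 f η := by
  rw [fourierF, Real.fourier_eq']
  refine integral_congr_ae (.of_forall fun x => ?_)
  simp only [smul_eq_mul, real_inner_smul_right]
  rw [mul_comm]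
  congr 2
  push_cast; ring

lemma fourierF_eq (f : Space N → ℂ) (ξ : Space N) :
    fourierF f ξ = 𝓕 f ((2 * Real.pi)⁻¹ • ξ) := by
  rw [← fourierF_two_pi_smul, smul_inv_smul₀ (by positivity)]

lemma invFourierF_eq (g : Space N → ℂ) (x : Space N) :
    invFourierF g x = 𝓕⁻ (fun η : Space N => g ((2 * Real.pi) • η)) x := by
  rw [invFourierF, Real.fourierInv_eq']
  have e := Measure.integral_comp_smul (volume : Measure (Space N))
    (fun ξ => g ξ * Complex.exp (Complex.I * ((inner ℝ x ξ : ℝ) : ℂ))) (2 * Real.pi)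
  rw [finrank_euclideanSpace_fin, abs_of_nonneg (by positivity), Complex.real_smul,
    Complex.ofReal_inv] at e
  rw [← e]
  refine integral_congr_ae (.of_forall fun η => ?_)
  simp only [smul_eq_mul, real_inner_smul_right]
  rw [mul_comm, real_inner_comm]
  congr 2
  push_cast; ring

lemma invFourierF_fourierF_schwartz (φ : 𝓢(Space N, ℂ)) (x : Space N) :
    invFourierF (fourierF φ) x = φ x := by
  rw [invFourierF_eq]
  simp_rw [fourierF_two_pi_smul]
  have : Integrable (𝓕 (φ : Space N → ℂ)) := by
    rw [← SchwartzMap.fourier_coe]; exact (𝓕 φ).integrable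
  rw [Continuous.fourierInv_fourier_eq φ.continuous φ.integrable this]

lemma integrable_pow_mul_fourierF_schwartz (φ : 𝓢(Space N, ℂ)) (k : ℕ) :
    Integrable fun ξ => ‖ξ‖ ^ k * ‖fourierF φ ξ‖ := by
  have h1 := ((𝓕 φ).integrable_pow_mul (volume : Measure (Space N)) k).comp_smul
    (R := (2 * Real.pi)⁻¹) (by positivity)
  refine (h1.const_mul ((2 * Real.pi) ^ k)).congr (.of_forall fun ξ => ?_)
  simp only [norm_smul, fourierF_eq]
  have e : (2 * Real.pi) ^ k * ((2 * Real.pi)⁻¹ * ‖ξ‖) ^ k = ‖ξ‖ ^ k := by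
    rw [← mul_pow, mul_inv_cancel_left₀ (by positivity)]
  rw [SchwartzMap.fourier_coe, Real.norm_of_nonneg (by positivity), ← mul_assoc, e]

lemma continuous_fourierF_schwartz (φ : 𝓢(Space N, ℂ)) : Continuous (fourierF φ) := by
  have : fourierF φ = fun ξ => (𝓕 φ) ((2 * Real.pi)⁻¹ • ξ) := by
    ext ξ; rw [fourierF_eq, SchwartzMap.fourier_coe]
  rw [this]
  exact (𝓕 φ).continuous.comp (by fun_prop)

lemma integrable_fourierF_schwartz (φ : 𝓢(Space N, ℂ)) : Integrable (fourierF φ) := by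
  have := integrable_pow_mul_fourierF_schwartz φ 0
  simp only [pow_zero, one_mul] at this
  exact (integrable_norm_iff (continuous_fourierF_schwartz φ).aestronglyMeasurable).1 this

lemma norm_exp_I_mul_ofReal (r : ℝ) : ‖Complex.exp (Complex.I * (r : ℂ))‖ = 1 := by
  rw [mul_comm, Complex.norm_exp_ofReal_mul_I]

lemma integrable_mul_exp_inner {g : Space N → ℂ} (hg : Integrable g) (x : Space N) :
    Integrable fun ξ => g ξ * Complex.exp (Complex.I * ((inner ℝ x ξ : ℝ) : ℂ)) := by
  refine hg.mono (hg.1.mul (by fun_prop)) (.of_forall fun ξ => ?_)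
  rw [norm_mul, norm_exp_I_mul_ofReal, mul_one]

lemma integral_mul_invFourierF {f ψ : Space N → ℂ} (hf : Integrable f) (hψ : Integrable ψ) :
    ∫ x, f x * invFourierF ψ x =
      (((2 * Real.pi) ^ N : ℝ) : ℂ)⁻¹ * ∫ ξ, fourierF f (-ξ) * ψ ξ := by
  have hi : Integrable (Function.uncurry fun x ξ : Space N =>
      f x * (ψ ξ * Complex.exp (Complex.I * ((inner ℝ x ξ : ℝ) : ℂ)))) (volume.prod volume) := by
    refine (hf.mul_prod hψ).mono ?_ (.of_forall fun p => ?_)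
    · simp only [Function.uncurry_def]
      exact hf.1.comp_fst.mul (hψ.1.comp_snd.mul (by fun_prop))
    · simp only [Function.uncurry_def, norm_mul, norm_exp_I_mul_ofReal, mul_one, le_refl]
  simp only [invFourierF, fourierF]
  simp_rw [mul_left_comm (f _), integral_const_mul]
  congr 1
  simp_rw [← integral_const_mul]
  rw [integral_integral_swap hi]
  refine integral_congr_ae (.of_forall fun ξ => ?_)
  simp only
  rw [← integral_mul_const]
  refine integral_congr_ae (.of_forall fun x => ?_)
  simp only [inner_neg_right, Complex.ofReal_neg, mul_neg, neg_neg]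
  ring

lemma re_invFourierF {g : Space N → ℝ} (hg : Integrable g) (x : Space N) :
    (invFourierF (fun ξ => (g ξ : ℂ)) x).re =
      ((2 * Real.pi) ^ N)⁻¹ * ∫ ξ, g ξ * Real.cos (inner ℝ x ξ) := by
  have hi : Integrable fun ξ => (g ξ : ℂ) * Complex.exp (Complex.I * ((inner ℝ x ξ : ℝ) : ℂ)) :=
    integrable_mul_exp_inner hg.ofReal x
  rw [invFourierF, ← Complex.ofReal_inv, Complex.re_ofReal_mul, ← RCLike.re_eq_complex_re,
    ← integral_re hi]
  congr 1
  refine integral_congr_ae (.of_forall fun ξ => ?_)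
  simp only [RCLike.re_eq_complex_re]
  rw [Complex.re_ofReal_mul, mul_comm Complex.I, Complex.exp_ofReal_mul_I_re]

lemma im_invFourierF_of_even {g : Space N → ℝ} (hg : Integrable g) (he : ∀ ξ, g (-ξ) = g ξ)
    (x : Space N) : (invFourierF (fun ξ => (g ξ : ℂ)) x).im = 0 := by
  have hi : Integrable fun ξ => (g ξ : ℂ) * Complex.exp (Complex.I * ((inner ℝ x ξ : ℝ) : ℂ)) :=
    integrable_mul_exp_inner hg.ofReal x
  rw [invFourierF, ← Complex.ofReal_inv, Complex.im_ofReal_mul, ← RCLike.im_eq_complex_im,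
    ← integral_im hi]
  have e : ∀ ξ, RCLike.im ((g ξ : ℂ) * Complex.exp (Complex.I * ((inner ℝ x ξ : ℝ) : ℂ))) =
      g ξ * Real.sin (inner ℝ x ξ) := fun ξ => by
    rw [RCLike.im_eq_complex_im, Complex.im_ofReal_mul, mul_comm Complex.I,
      Complex.exp_ofReal_mul_I_im]
  have h0 : ∫ ξ, g ξ * Real.sin (inner ℝ x ξ) = -∫ ξ, g ξ * Real.sin (inner ℝ x ξ) := by
    rw [← integral_neg, ← integral_neg_eq_self]
    simp [he, inner_neg_right]
  refine mul_eq_zero_of_right _ ?_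
  refine Eq.trans (integral_congr_ae (.of_forall e)) ?_
  linarith

end FourierConventions

/-! ### Positivity, integrability and inversion for limits of characteristic functions. -/

section Bochner

variable {N : ℕ} {g : Space N → ℝ}

lemma continuous_integral_mul_cos (hg : Integrable g) :
    Continuous fun x : Space N => ∫ ξ, g ξ * Real.cos (inner ℝ x ξ) := by
  refine continuous_of_dominated (bound := fun ξ => ‖g ξ‖)
    (fun x => hg.1.mul (by fun_prop)) (fun x => .of_forall fun ξ => ?_) hg.norm
    (.of_forall fun ξ => by fun_prop)
  rw [norm_mul]
  exact mul_le_of_le_one_right (norm_nonneg _) (Real.abs_cos_le_one _)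

/-- By Fubini this is the ν-average of the Fourier transform of a Gaussian at y + x, which is
positive. -/
lemma integral_re_charFun_mul_gaussian_nonneg (ν : Measure (Space N)) [IsProbabilityMeasure ν]
    {ε : ℝ} (hε : 0 < ε) (x : Space N) :
    0 ≤ ∫ ξ, Real.exp (-ε * ‖ξ‖ ^ 2) *
      (charFun ν ξ * Complex.exp (Complex.I * ((inner ℝ x ξ : ℝ) : ℂ))).re := by
  have hg := integrable_exp_neg_mul_sq_norm (V := Space N) hε
  have e : ∀ ξ, (charFun ν ξ * Complex.exp (Complex.I * ((inner ℝ x ξ : ℝ) : ℂ))).re =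
      ∫ y, Real.cos (inner ℝ (y + x) ξ) ∂ν := by
    intro ξ
    rw [charFun_apply, ← integral_mul_const, ← RCLike.re_eq_complex_re, ← integral_re]
    · refine integral_congr_ae (.of_forall fun y => ?_)
      simp only [RCLike.re_eq_complex_re]
      rw [← Complex.exp_add, ← Complex.exp_ofReal_mul_I_re, inner_add_left]
      push_cast; ring_nf
    · refine (integrable_const (1 : ℝ)).mono' (by fun_prop) (.of_forall fun y => ?_)
      rw [norm_mul, norm_exp_I_mul_ofReal, Complex.norm_exp_ofReal_mul_I, one_mul]
  simp_rw [e, ← integral_const_mul]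
  rw [integral_integral_swap]
  · refine integral_nonneg fun y => ?_
    have e2 : ∀ ξ : Space N, (inner ℝ (y + x) ξ : ℝ) = inner ℝ ξ (y + x) :=
      fun ξ => real_inner_comm _ _
    simp_rw [e2]
    rw [integral_exp_neg_mul_sq_norm_mul_cos hε (y + x)]
    positivity
  · refine (hg.mul_prod (integrable_const (1 : ℝ) (μ := ν))).mono (by fun_prop)
      (.of_forall fun p => ?_)
    simp only [Function.uncurry_def, norm_mul, mul_one]
    exact mul_le_of_le_one_right (norm_nonneg _) (Real.abs_cos_le_one _)

/-- An integrable pointwise limit of characteristic functions has nonnegative Fourier integrals. -/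
lemma integral_mul_cos_nonneg (hg : Integrable g) {ν : ℕ → Measure (Space N)}
    [∀ n, IsProbabilityMeasure (ν n)]
    (hν : ∀ ξ, Tendsto (fun n => charFun (ν n) ξ) atTop (𝓝 (g ξ : ℂ))) (x : Space N) :
    0 ≤ ∫ ξ, g ξ * Real.cos (inner ℝ x ξ) := by
  -- The characteristic functions are only bounded by 1, so the Gaussian factor supplies the
  -- dominating function; it is removed afterwards, with |g| dominating.
  have h1 : ∀ ε : ℝ, 0 < ε → 0 ≤ ∫ ξ, Real.exp (-ε * ‖ξ‖ ^ 2) * (g ξ * Real.cos (inner ℝ x ξ)) := by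
    intro ε hε
    refine ge_of_tendsto' (x := atTop) (tendsto_integral_of_dominated_convergence
      (fun ξ => Real.exp (-ε * ‖ξ‖ ^ 2)) (fun n => ?_)
      (integrable_exp_neg_mul_sq_norm hε) (fun n => .of_forall fun ξ => ?_)
      (.of_forall fun ξ => ?_))
      (fun n => integral_re_charFun_mul_gaussian_nonneg (ν n) hε x)
    · have := measurable_charFun (μ := ν n)
      exact Measurable.aestronglyMeasurable (by fun_prop)
    · rw [norm_mul, Real.norm_of_nonneg (Real.exp_pos _).le]
      refine mul_le_of_le_one_right (Real.exp_pos _).le ?_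
      refine (Complex.abs_re_le_norm _).trans ?_
      rw [norm_mul, norm_exp_I_mul_ofReal, mul_one]
      exact norm_charFun_le_one ξ
    · refine Tendsto.const_mul _ ?_
      have h2 := (Complex.continuous_re.tendsto _).comp
        ((hν ξ).mul_const (Complex.exp (Complex.I * ((inner ℝ x ξ : ℝ) : ℂ))))
      rw [Complex.re_ofReal_mul, mul_comm Complex.I, Complex.exp_ofReal_mul_I_re] at h2
      simp only [mul_comm Complex.I] at h2 ⊢
      exact h2
  have h2 : Tendsto (fun n : ℕ => ∫ ξ, Real.exp (-(1 / ((n : ℝ) + 1)) * ‖ξ‖ ^ 2) *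
      (g ξ * Real.cos (inner ℝ x ξ))) atTop (𝓝 (∫ ξ, g ξ * Real.cos (inner ℝ x ξ))) := by
    refine tendsto_integral_of_dominated_convergence (fun ξ => ‖g ξ‖)
      (fun n => (Continuous.aestronglyMeasurable (by fun_prop)).mul (hg.1.mul (by fun_prop)))
      hg.norm (fun n => .of_forall fun ξ => ?_) (.of_forall fun ξ => ?_)
    · rw [norm_mul, norm_mul, Real.norm_of_nonneg (Real.exp_pos _).le]
      have h3 : Real.exp (-(1 / ((n : ℝ) + 1)) * ‖ξ‖ ^ 2) ≤ 1 := by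
        rw [Real.exp_le_one_iff, neg_mul, neg_nonpos]; positivity
      calc _ ≤ 1 * (‖g ξ‖ * 1) := by
            gcongr
            exact Real.abs_cos_le_one _
        _ = _ := by ring
    · have h3 : Tendsto (fun n : ℕ => Real.exp (-(1 / ((n : ℝ) + 1)) * ‖ξ‖ ^ 2)) atTop (𝓝 1) := by
        have := ((tendsto_one_div_add_atTop_nhds_zero_nat (𝕜 := ℝ)).neg.mul_const (‖ξ‖ ^ 2)).rexp
        simpa using this
      simpa using h3.mul_const (g ξ * Real.cos (inner ℝ x ξ))
  exact ge_of_tendsto' h2 fun n => h1 _ (by positivity)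

/-- Fubini moves the Gaussian to the Fourier side, and (π/ε)^(N/2) (4πε)^(N/2) = (2π)^N does not
depend on ε. -/
lemma integral_gaussian_mul_integral_cos_le (hg : Integrable g) (hg1 : ∀ ξ, g ξ ≤ 1)
    {ε : ℝ} (hε : 0 < ε) :
    ∫ x : Space N, Real.exp (-ε * ‖x‖ ^ 2) * ∫ ξ, g ξ * Real.cos (inner ℝ x ξ) ≤
      (2 * Real.pi) ^ N := by
  have hpi := Real.pi_pos
  have hγ := integrable_exp_neg_mul_sq_norm (V := Space N) hε
  have hγ' := integrable_exp_neg_mul_sq_norm (V := Space N) (r := 1 / (4 * ε)) (by positivity)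
  simp_rw [← integral_const_mul]
  rw [integral_integral_swap]
  · have e : ∀ ξ : Space N, ∫ x : Space N, Real.exp (-ε * ‖x‖ ^ 2) *
        (g ξ * Real.cos (inner ℝ x ξ)) = (Real.pi / ε) ^ ((N : ℝ) / 2) *
          (g ξ * Real.exp (-(1 / (4 * ε)) * ‖ξ‖ ^ 2)) := by
      intro ξ
      simp_rw [mul_left_comm _ (g ξ)]
      rw [integral_const_mul, integral_exp_neg_mul_sq_norm_mul_cos hε, finrank_euclideanSpace_fin,
        show -(‖ξ‖ ^ 2 / 4 / ε) = -(1 / (4 * ε)) * ‖ξ‖ ^ 2 by field_simp]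
    simp_rw [e]
    rw [integral_const_mul]
    have h1 : ∫ ξ, g ξ * Real.exp (-(1 / (4 * ε)) * ‖ξ‖ ^ 2) ≤
        ∫ ξ : Space N, Real.exp (-(1 / (4 * ε)) * ‖ξ‖ ^ 2) := by
      refine integral_mono ?_ hγ' fun ξ => mul_le_of_le_one_left (Real.exp_pos _).le (hg1 ξ)
      refine hg.mono (hg.1.mul (by fun_prop)) (.of_forall fun ξ => ?_)
      rw [norm_mul, Real.norm_of_nonneg (Real.exp_pos _).le]
      refine mul_le_of_le_one_right (norm_nonneg _) ?_
      rw [Real.exp_le_one_iff, neg_mul, neg_nonpos]; positivity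
    rw [GaussianFourier.integral_rexp_neg_mul_sq_norm (by positivity),
      finrank_euclideanSpace_fin] at h1
    calc _ ≤ (Real.pi / ε) ^ ((N : ℝ) / 2) * (Real.pi / (1 / (4 * ε))) ^ ((N : ℝ) / 2) := by
          gcongr
      _ = ((2 * Real.pi) ^ (2 : ℝ)) ^ ((N : ℝ) / 2) := by
          rw [← Real.mul_rpow (by positivity) (by positivity)]
          congr 1
          rw [Real.rpow_two]
          field_simp
          ring
      _ = (2 * Real.pi) ^ N := by
          rw [← Real.rpow_mul (by positivity), ← Real.rpow_natCast]
          congr 1; ring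
  · refine (hγ.mul_prod hg).mono ?_ (.of_forall fun p => ?_)
    · simp only [Function.uncurry_def]
      exact AEStronglyMeasurable.mul (by fun_prop) (hg.1.comp_snd.mul (by fun_prop))
    · simp only [Function.uncurry_def, norm_mul, ← mul_assoc]
      exact mul_le_of_le_one_right (by positivity) (Real.abs_cos_le_one _)

/-- Fatou along ε = 1/(n + 1): the damped integrals are bounded uniformly and positivity excludes
cancellation. -/
lemma integrable_integral_mul_cos (hg : Integrable g) (hg1 : ∀ ξ, g ξ ≤ 1)
    (hpos : ∀ x : Space N, 0 ≤ ∫ ξ, g ξ * Real.cos (inner ℝ x ξ)) :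
    Integrable fun x : Space N => ∫ ξ, g ξ * Real.cos (inner ℝ x ξ) := by
  set p : Space N → ℝ := fun x => ∫ ξ, g ξ * Real.cos (inner ℝ x ξ) with hp
  have hpc : Continuous p := continuous_integral_mul_cos hg
  set f : ℕ → Space N → ENNReal := fun n x =>
    ENNReal.ofReal (Real.exp (-(1 / ((n : ℝ) + 1)) * ‖x‖ ^ 2) * p x) with hf
  have hle : ∀ n, ∫⁻ x, f n x ≤ ENNReal.ofReal ((2 * Real.pi) ^ N) := by
    intro n
    have hn : 0 < 1 / ((n : ℝ) + 1) := by positivity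
    have hi : Integrable fun x => Real.exp (-(1 / ((n : ℝ) + 1)) * ‖x‖ ^ 2) * p x := by
      refine ((integrable_exp_neg_mul_sq_norm (V := Space N) hn).mul_const (∫ ξ, ‖g ξ‖)).mono'
        (by fun_prop) (.of_forall fun x => ?_)
      rw [norm_mul, Real.norm_of_nonneg (Real.exp_pos _).le]
      gcongr
      refine (norm_integral_le_integral_norm _).trans (integral_mono_of_nonneg
        (.of_forall fun _ => norm_nonneg _) hg.norm (.of_forall fun ξ => ?_))
      simp only [norm_mul]
      exact mul_le_of_le_one_right (norm_nonneg _) (Real.abs_cos_le_one _)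
    rw [hf, ← ofReal_integral_eq_lintegral_ofReal hi (.of_forall fun x =>
      mul_nonneg (Real.exp_pos _).le (hpos x))]
    exact ENNReal.ofReal_le_ofReal (integral_gaussian_mul_integral_cos_le hg hg1 hn)
  have hlim : ∀ x, Tendsto (fun n => f n x) atTop (𝓝 (ENNReal.ofReal (p x))) := by
    intro x
    refine (ENNReal.continuous_ofReal.tendsto _).comp ?_
    have := ((tendsto_one_div_add_atTop_nhds_zero_nat (𝕜 := ℝ)).neg.mul_const (‖x‖ ^ 2)).rexp
    simpa using this.mul_const (p x)
  have hfin : ∫⁻ x, ENNReal.ofReal (p x) ≤ ENNReal.ofReal ((2 * Real.pi) ^ N) := by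
    calc ∫⁻ x, ENNReal.ofReal (p x) = ∫⁻ x, liminf (fun n => f n x) atTop :=
          lintegral_congr fun x => (hlim x).liminf_eq.symm
      _ ≤ liminf (fun n => ∫⁻ x, f n x) atTop := lintegral_liminf_le fun n => by fun_prop
      _ ≤ _ := liminf_le_of_le ⟨0, by simp⟩ fun b hb => by
          obtain ⟨n, hn⟩ := hb.exists
          exact hn.trans (hle n)
  refine ⟨hpc.aestronglyMeasurable, ?_⟩
  rw [hasFiniteIntegral_iff_ofReal (.of_forall hpos)]
  exact hfin.trans_lt ENNReal.ofReal_lt_top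

open scoped FourierTransform in
lemma fourierF_invFourierF_of_even {p : Space N → ℝ} (hg : Integrable g) (hgc : Continuous g)
    (he : ∀ ξ, g (-ξ) = g ξ) (hp : ∀ x, (p x : ℂ) = invFourierF (fun ξ => (g ξ : ℂ)) x)
    (hpi : Integrable p) (ξ : Space N) : fourierF (fun x => (p x : ℂ)) ξ = g ξ := by
  set G₂ : Space N → ℂ := fun η => (g ((2 * Real.pi) • η) : ℂ) with hG
  have h1 : (fun x => (p x : ℂ)) = 𝓕⁻ G₂ := by
    ext x; rw [hp, invFourierF_eq]
  have hGi : Integrable G₂ := (hg.comp_smul (R := 2 * Real.pi) (by positivity)).ofReal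
  have hGc : Continuous G₂ := by fun_prop
  -- For even g both transforms agree, so integrability of p is the hypothesis that the inversion
  -- theorem needs.
  have h2 : 𝓕 G₂ = fun x => (p x : ℂ) := by
    rw [h1, Real.fourierInv_eq_fourier_comp_neg]
    congr 1
    ext η
    simp [hG, he]
  rw [fourierF_eq, h1, Continuous.fourier_fourierInv_eq hGc hGi (by rw [h2]; exact hpi.ofReal), hG]
  simp only
  rw [smul_inv_smul₀ (by positivity)]

end Bochner

/-! ### Growth and continuity of the symbol; integrability of e^{sB}. -/

section Symbol

variable {N : ℕ} (a : Measure ℝ)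

lemma symbol_nonpos (ξ : Space N) : symbol a ξ ≤ 0 := by
  rw [symbol, neg_nonpos]
  exact integral_nonneg fun α => by simp only [Pi.zero_apply]; positivity

lemma exp_symbol_le_one {s : ℝ} (hs : 0 ≤ s) (ξ : Space N) : Real.exp (s * symbol a ξ) ≤ 1 :=
  Real.exp_le_one_iff.2 (mul_nonpos_of_nonneg_of_nonpos hs (symbol_nonpos a ξ))

lemma symbol_neg (ξ : Space N) : symbol a (-ξ) = symbol a ξ := by
  simp only [symbol, norm_neg]

lemma symbol_zero : symbol a (0 : Space N) = 0 := by
  rw [symbol, neg_eq_zero]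
  refine (setIntegral_congr_fun measurableSet_Ioc fun α hα => ?_).trans (integral_zero _ _)
  simp only [norm_zero]
  exact Real.zero_rpow hα.1.ne'

variable [IsFiniteMeasure a]

lemma abs_symbol_le (ξ : Space N) : |symbol a ξ| ≤ (1 + ‖ξ‖ ^ 2) * a.real (Ioc 0 2) := by
  rw [symbol, abs_neg, ← Real.norm_eq_abs]
  have := norm_setIntegral_le_of_norm_le_const (μ := a) (s := Ioc (0 : ℝ) 2)
    (f := fun α : ℝ => ‖ξ‖ ^ α) (C := 1 + ‖ξ‖ ^ 2) (measure_lt_top _ _) fun α hα => by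
      rw [Real.norm_of_nonneg (by positivity)]
      exact rpow_le_one_add_sq (norm_nonneg _) hα
  exact this

lemma continuous_symbol : Continuous (symbol a : Space N → ℝ) := by
  rw [continuous_iff_continuousAt]
  intro ξ₀
  refine ContinuousAt.neg (continuousAt_of_dominated (bound := fun _ => 1 + (‖ξ₀‖ + 1) ^ 2)
    (.of_forall fun ξ => Measurable.aestronglyMeasurable (by fun_prop)) ?_
    (integrable_const _) ?_)
  · filter_upwards [Metric.ball_mem_nhds ξ₀ one_pos] with ξ hξ
    filter_upwards [self_mem_ae_restrict measurableSet_Ioc] with α hα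
    rw [Real.norm_of_nonneg (by positivity)]
    refine (rpow_le_one_add_sq (norm_nonneg _) hα).trans ?_
    have h1 : ‖ξ‖ ≤ ‖ξ₀‖ + 1 := by
      have h2 : ‖ξ - ξ₀‖ < 1 := by simpa [dist_eq_norm] using hξ
      have := norm_le_norm_add_norm_sub' ξ ξ₀
      linarith
    gcongr
  · filter_upwards [self_mem_ae_restrict measurableSet_Ioc] with α hα
    exact continuous_norm.continuousAt.rpow_const (Or.inr hα.1.le)

lemma exists_measure_Icc_pos {a : Measure ℝ} (ha_pos : 0 < a (Ioc 0 2)) :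
    ∃ ε : ℝ, 0 < ε ∧ 0 < a (Icc ε 2) := by
  by_contra! hn
  refine ha_pos.ne' (measure_mono_null (t := ⋃ n : ℕ, Icc (1 / ((n : ℝ) + 1)) 2) ?_
    (measure_iUnion_null fun n => le_antisymm (hn _ (by positivity)) bot_le))
  intro α hα
  obtain ⟨n, hn⟩ := exists_nat_one_div_lt hα.1
  exact mem_iUnion.2 ⟨n, hn.le, hα.2⟩

lemma symbol_le_neg_rpow {ε : ℝ} (hε : 0 < ε) {ξ : Space N} (hξ : 1 ≤ ‖ξ‖) :
    symbol a ξ ≤ -(a.real (Icc ε 2) * ‖ξ‖ ^ ε) := by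
  rw [symbol, neg_le_neg_iff]
  have hsub : Icc ε 2 ⊆ Ioc (0 : ℝ) 2 := fun α hα => ⟨hε.trans_le hα.1, hα.2⟩
  calc a.real (Icc ε 2) * ‖ξ‖ ^ ε = ∫ _ in Icc ε 2, ‖ξ‖ ^ ε ∂a := by
        rw [setIntegral_const, smul_eq_mul]
    _ ≤ ∫ α in Icc ε 2, ‖ξ‖ ^ α ∂a :=
        setIntegral_mono_on (integrable_const _) ((integrableOn_norm_rpow a ξ).mono_set hsub)
          measurableSet_Icc fun α hα => Real.rpow_le_rpow_of_exponent_le hξ hα.1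
    _ ≤ ∫ α in Ioc 0 2, ‖ξ‖ ^ α ∂a :=
        setIntegral_mono_set (integrableOn_norm_rpow a ξ)
          (.of_forall fun α => by simp only [Pi.zero_apply]; positivity) hsub.eventuallyLE

lemma continuous_exp_symbol (s : ℝ) : Continuous fun ξ : Space N => Real.exp (s * symbol a ξ) := by
  have := continuous_symbol (N := N) a
  fun_prop

lemma integrable_exp_symbol (ha_pos : 0 < a (Ioc 0 2)) {s : ℝ} (hs : 0 < s) :
    Integrable fun ξ : Space N => Real.exp (s * symbol a ξ) := by
  obtain ⟨ε, hε, hm⟩ := exists_measure_Icc_pos ha_pos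
  set c : ℝ := s * a.real (Icc ε 2) with hc
  have hc0 : 0 < c := mul_pos hs (ENNReal.toReal_pos hm.ne' (measure_ne_top _ _))
  -- With εk ≥ N + 1, the bound e^{-x} ≤ k!/x^k at x = c|ξ|^ε yields decay of order |ξ|^(-N-1),
  -- which is integrable.
  obtain ⟨k, hk⟩ := exists_nat_ge (((N : ℝ) + 1) / ε)
  rw [div_le_iff₀ hε] at hk
  have hJ := integrable_one_add_norm (E := Space N) (μ := volume) (r := (N : ℝ) + 1)
    (by rw [finrank_euclideanSpace_fin]; linarith)
  refine (hJ.const_mul (2 ^ (N + 1) * (1 + k.factorial / c ^ k))).mono'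
    (continuous_exp_symbol a s).aestronglyMeasurable (.of_forall fun ξ => ?_)
  rw [Real.norm_of_nonneg (Real.exp_pos _).le, Real.rpow_neg (by positivity), ← div_eq_mul_inv,
    le_div_iff₀ (by positivity)]
  have e : (1 + ‖ξ‖) ^ ((N : ℝ) + 1) = (1 + ‖ξ‖) ^ (N + 1) := by
    rw [← Real.rpow_natCast]; push_cast; rfl
  rw [e]
  have hK : 0 ≤ (k.factorial : ℝ) / c ^ k := by positivity
  rcases le_total ‖ξ‖ 1 with h1 | h1
  · have h2 : (1 + ‖ξ‖) ^ (N + 1) ≤ 2 ^ (N + 1) := by gcongr; linarith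
    calc _ ≤ 1 * 2 ^ (N + 1) := by
          gcongr
          exact exp_symbol_le_one a hs.le ξ
      _ ≤ 2 ^ (N + 1) * (1 + k.factorial / c ^ k) := by
          have : (0 : ℝ) < 2 ^ (N + 1) := by positivity
          nlinarith
  · have hξ0 : 0 < ‖ξ‖ := by linarith
    have h2 : (1 + ‖ξ‖) ^ (N + 1) ≤ 2 ^ (N + 1) * (‖ξ‖ ^ ε) ^ k := by
      calc (1 + ‖ξ‖) ^ (N + 1) ≤ (2 * ‖ξ‖) ^ (N + 1) := by gcongr; linarith
        _ = 2 ^ (N + 1) * ‖ξ‖ ^ ((N : ℝ) + 1) := by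
            rw [mul_pow, ← Real.rpow_natCast ‖ξ‖]; push_cast; rfl
        _ ≤ 2 ^ (N + 1) * ‖ξ‖ ^ (ε * k) := by
            gcongr
            · linarith
        _ = _ := by rw [Real.rpow_mul hξ0.le, Real.rpow_natCast]
    have h3 : Real.exp (s * symbol a ξ) ≤ k.factorial / (c * ‖ξ‖ ^ ε) ^ k := by
      have h4 : s * symbol a ξ ≤ -(c * ‖ξ‖ ^ ε) := by
        have := mul_le_mul_of_nonneg_left (symbol_le_neg_rpow a hε h1) hs.le
        rw [hc]; linarith
      have h5 : 0 < (c * ‖ξ‖ ^ ε) ^ k := by positivity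
      have h6 := Real.pow_div_factorial_le_exp (x := c * ‖ξ‖ ^ ε) (by positivity) k
      calc Real.exp (s * symbol a ξ) ≤ Real.exp (-(c * ‖ξ‖ ^ ε)) := Real.exp_le_exp.2 h4
        _ = 1 / Real.exp (c * ‖ξ‖ ^ ε) := by rw [Real.exp_neg, one_div]
        _ ≤ 1 / ((c * ‖ξ‖ ^ ε) ^ k / k.factorial) :=
            one_div_le_one_div_of_le (by positivity) h6
        _ = _ := by rw [one_div_div]
    calc _ ≤ k.factorial / (c * ‖ξ‖ ^ ε) ^ k * (2 ^ (N + 1) * (‖ξ‖ ^ ε) ^ k) := by gcongr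
      _ = 2 ^ (N + 1) * (k.factorial / c ^ k) := by
          have := (Real.rpow_pos_of_pos hξ0 ε).ne'
          rw [mul_pow]; field_simp
      _ ≤ _ := by gcongr; linarith

end Symbol

/-! ### Every e^{sB} as a limit of characteristic functions. -/

section Approximation

variable {N : ℕ}

lemma tendsto_one_sub_div_mul_pow {c : ℕ → ℝ} {b : ℝ} (hc : Tendsto c atTop (𝓝 b)) (r : ℝ) :
    Tendsto (fun n : ℕ => (1 - r / n * c n) ^ n) atTop (𝓝 (Real.exp (-(r * b)))) := by
  have := Real.tendsto_one_add_pow_exp_of_tendsto (g := fun n : ℕ => -(r / n * c n))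
    (t := -(r * b)) ?_
  · simpa only [sub_eq_add_neg] using this
  · refine ((hc.const_mul r).neg).congr' ?_
    filter_upwards [eventually_ne_atTop 0] with n hn
    field_simp

/-- A lazy step: move according to μ with probability r, stay at 0 otherwise. -/
lemma exists_charFun_eq_one_sub_mul (μ : Measure (Space N)) [IsProbabilityMeasure μ] {r : ℝ}
    (h0 : 0 ≤ r) (h1 : r ≤ 1) : ∃ ν : Measure (Space N), IsProbabilityMeasure ν ∧
      ∀ ξ, charFun ν ξ = 1 - r * (1 - charFun μ ξ) := by
  refine ⟨ENNReal.ofReal (1 - r) • Measure.dirac 0 + ENNReal.ofReal r • μ, ⟨?_⟩, fun ξ => ?_⟩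
  · simp only [Measure.coe_add, Measure.coe_smul, Pi.add_apply, Pi.smul_apply, measure_univ,
      smul_eq_mul, mul_one]
    rw [← ENNReal.ofReal_add (by linarith) h0]
    simp
  · have hi : ∀ ν : Measure (Space N), IsFiniteMeasure ν →
        Integrable (fun x => Complex.exp ((inner ℝ x ξ : ℝ) * Complex.I)) ν := fun ν _ =>
      (integrable_const (1 : ℝ)).mono' (by fun_prop) (.of_forall fun x => by
        rw [Complex.norm_exp_ofReal_mul_I])
    rw [charFun_apply, integral_add_measure ((hi _ inferInstance).smul_measure ENNReal.ofReal_ne_top)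
      ((hi _ inferInstance).smul_measure ENNReal.ofReal_ne_top), integral_smul_measure,
      integral_smul_measure, ← charFun_apply, ← charFun_apply, charFun_dirac,
      ENNReal.toReal_ofReal (by linarith), ENNReal.toReal_ofReal h0]
    simp only [inner_zero_left, Complex.ofReal_zero, zero_mul, Complex.exp_zero, Complex.real_smul]
    push_cast; ring

/-- If `1 - (t / n) c n` are characteristic functions and `c n → b`, then `exp (-s b)` is a limit
of characteristic functions for every `s > 0`. -/
lemma exists_tendsto_charFun {t : ℝ} (ht : 0 < t) {μ : ℕ → Measure (Space N)}
    (hμ : ∀ n, IsProbabilityMeasure (μ n)) {c : ℕ → Space N → ℝ} {b : Space N → ℝ}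
    (hc : ∀ n, 1 ≤ n → ∀ ξ, charFun (μ n) ξ = ((1 - t / n * c n ξ : ℝ) : ℂ))
    (hb : ∀ ξ, Tendsto (fun n => c n ξ) atTop (𝓝 (b ξ))) {s : ℝ} (hs : 0 < s) :
    ∃ ν : ℕ → Measure (Space N), (∀ n, IsProbabilityMeasure (ν n)) ∧
      ∀ ξ, Tendsto (fun n => charFun (ν n) ξ) atTop (𝓝 (Real.exp (-(s * b ξ)) : ℂ)) := by
  -- K makes the laziness r = s/(Kt) at most 1; taking nK lazy steps instead of n restores the total
  -- time s.
  obtain ⟨K, hK⟩ := exists_nat_ge (s / t)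
  have hK0 : (0 : ℝ) < K := (div_pos hs ht).trans_le hK
  set r : ℝ := s / (K * t) with hr
  have hr0 : 0 ≤ r := by positivity
  have hr1 : r ≤ 1 := by
    rw [hr, div_le_one (by positivity)]
    rwa [div_le_iff₀ ht] at hK
  choose ν hνp hν using fun n => exists_charFun_eq_one_sub_mul (μ n) hr0 hr1
  refine ⟨fun n => (Measure.pi fun _ : Fin (n * K) => ν n).map (fun p => ∑ i, p i),
    fun n => Measure.isProbabilityMeasure_map (Measurable.aemeasurable (by fun_prop)),
    fun ξ => ?_⟩
  have h1 := ((tendsto_one_sub_div_mul_pow (hb ξ) (s / K)).pow K)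
  have h2 : Real.exp (-(s / K * b ξ)) ^ K = Real.exp (-(s * b ξ)) := by
    rw [← Real.exp_nat_mul]; congr 1; field_simp
  rw [h2] at h1
  refine ((Complex.continuous_ofReal.tendsto _).comp h1).congr' ?_
  filter_upwards [eventually_ge_atTop 1] with n hn
  have hn0 : (n : ℝ) ≠ 0 := by positivity
  rw [charFun_map_sum_pi_eq_prod]
  simp only [Finset.prod_const, Finset.card_univ, Fintype.card_fin, Pi.pow_apply,
    Function.comp_apply]
  rw [hν, hc n hn, ← pow_mul]
  have : 1 - s / K / n * c n ξ = 1 - r * (1 - (1 - t / n * c n ξ)) := by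
    rw [hr]; field_simp; ring
  rw [this]
  push_cast; rfl

end Approximation

/-! ### G(s, ·) as a density with characteristic function e^{sB}. -/

section Density

variable {N : ℕ} (a : Measure ℝ) [IsFiniteMeasure a]

lemma G_eq (ha_pos : 0 < a (Ioc 0 2)) {s : ℝ} (hs : 0 < s) (x : Space N) :
    G a s x = ((2 * Real.pi) ^ N)⁻¹ *
      ∫ ξ, Real.exp (s * symbol a ξ) * Real.cos (inner ℝ x ξ) := by
  rw [G, ← re_invFourierF (integrable_exp_symbol a ha_pos hs)]
  simp only [Complex.ofReal_exp]

lemma ofReal_G_eq (ha_pos : 0 < a (Ioc 0 2)) {s : ℝ} (hs : 0 < s) (x : Space N) :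
    (G a s x : ℂ) = invFourierF (fun ξ => Complex.exp ((s * symbol a ξ : ℝ) : ℂ)) x := by
  have h := im_invFourierF_of_even (integrable_exp_symbol (N := N) a ha_pos hs)
    (fun ξ => by simp only [symbol_neg]) x
  simp only [Complex.ofReal_exp] at h
  exact Complex.ext (by rw [Complex.ofReal_re, G]) (by rw [Complex.ofReal_im, h])

variable {a} {s : ℝ} {ν : ℕ → Measure (Space N)} [∀ n, IsProbabilityMeasure (ν n)]

lemma G_nonneg (ha_pos : 0 < a (Ioc 0 2)) (hs : 0 < s)
    (hν : ∀ ξ, Tendsto (fun n => charFun (ν n) ξ) atTop (𝓝 (Real.exp (s * symbol a ξ) : ℂ)))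
    (x : Space N) : 0 ≤ G a s x := by
  rw [G_eq a ha_pos hs]
  exact mul_nonneg (by positivity)
    (integral_mul_cos_nonneg (integrable_exp_symbol a ha_pos hs) hν x)

lemma integrable_G (ha_pos : 0 < a (Ioc 0 2)) (hs : 0 < s)
    (hν : ∀ ξ, Tendsto (fun n => charFun (ν n) ξ) atTop (𝓝 (Real.exp (s * symbol a ξ) : ℂ))) :
    Integrable (G a s : Space N → ℝ) := by
  have hi := integrable_exp_symbol (N := N) a ha_pos hs
  have h := (integrable_integral_mul_cos hi (exp_symbol_le_one a hs.le)
    (integral_mul_cos_nonneg hi hν)).const_mul (((2 * Real.pi) ^ N)⁻¹)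
  exact h.congr (.of_forall fun x => (G_eq a ha_pos hs x).symm)

lemma fourierF_G (ha_pos : 0 < a (Ioc 0 2)) (hs : 0 < s) (hi : Integrable (G a s : Space N → ℝ))
    (ξ : Space N) : fourierF (fun x => (G a s x : ℂ)) ξ = (Real.exp (s * symbol a ξ) : ℂ) := by
  refine fourierF_invFourierF_of_even (integrable_exp_symbol a ha_pos hs)
    (continuous_exp_symbol a s) (fun ξ => by simp only [symbol_neg]) (fun x => ?_) hi ξ
  rw [ofReal_G_eq a ha_pos hs]
  simp only [Complex.ofReal_exp]

lemma integral_G (ha_pos : 0 < a (Ioc 0 2)) (hs : 0 < s)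
    (hi : Integrable (G a s : Space N → ℝ)) : ∫ x : Space N, G a s x = 1 := by
  have h := fourierF_G ha_pos hs hi 0
  simp only [fourierF, inner_zero_right, Complex.ofReal_zero, mul_zero, neg_zero, Complex.exp_zero,
    mul_one, symbol_zero, Real.exp_zero, Complex.ofReal_one] at h
  rw [integral_complex_ofReal] at h
  exact_mod_cast h

lemma charFun_withDensity_G (ha_pos : 0 < a (Ioc 0 2)) (hs : 0 < s)
    (hi : Integrable (G a s : Space N → ℝ)) (h0 : ∀ x : Space N, 0 ≤ G a s x) (ξ : Space N) :
    charFun (volume.withDensity fun x => ENNReal.ofReal (G a s x)) ξ =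
      (Real.exp (s * symbol a ξ) : ℂ) := by
  rw [← symbol_neg, ← fourierF_G ha_pos hs hi, charFun_apply,
    integral_withDensity_eq_integral_toReal_smul₀ hi.1.aemeasurable.ennreal_ofReal
      (.of_forall fun _ => ENNReal.ofReal_lt_top), fourierF]
  refine integral_congr_ae (.of_forall fun x => ?_)
  simp only [ENNReal.toReal_ofReal (h0 x), Complex.real_smul, inner_neg_right, Complex.ofReal_neg,
    mul_neg, neg_neg]
  rw [mul_comm Complex.I]

lemma integral_G_mul_invFourierF (ha_pos : 0 < a (Ioc 0 2)) (hs : 0 < s)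
    (hi : Integrable (G a s : Space N → ℝ)) {ψ : Space N → ℂ} (hψ : Integrable ψ) :
    ∫ x, (G a s x : ℂ) * invFourierF ψ x = (((2 * Real.pi) ^ N : ℝ) : ℂ)⁻¹ *
      ∫ ξ, (Real.exp (s * symbol a ξ) : ℂ) * ψ ξ := by
  have hi' : Integrable fun x : Space N => (G a s x : ℂ) := hi.ofReal
  rw [integral_mul_invFourierF hi' hψ]
  have : ∀ ξ : Space N, fourierF (fun x => (G a s x : ℂ)) (-ξ) =
      (Real.exp (s * symbol a ξ) : ℂ) := fun ξ => by
    rw [fourierF_G ha_pos hs hi, symbol_neg]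
  simp only [this]

end Density

/-! ### The weak equation and the initial condition on the Fourier side. -/

section Equation

variable {N : ℕ} (a : Measure ℝ) [IsFiniteMeasure a]

lemma integrable_symbol_mul_fourierF (φ : 𝓢(Space N, ℂ)) :
    Integrable fun ξ => (symbol a ξ : ℂ) * fourierF φ ξ := by
  have hc := continuous_symbol (N := N) a
  have hf := continuous_fourierF_schwartz φ
  have h0 := integrable_fourierF_schwartz φ
  have h2 := integrable_pow_mul_fourierF_schwartz φ 2
  refine ((h0.norm.add h2).const_mul (a.real (Ioc 0 2))).mono'
    (Continuous.aestronglyMeasurable (by fun_prop)) (.of_forall fun ξ => ?_)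
  rw [norm_mul, Complex.norm_real, Real.norm_eq_abs, Pi.add_apply]
  calc _ ≤ ((1 + ‖ξ‖ ^ 2) * a.real (Ioc 0 2)) * ‖fourierF φ ξ‖ := by
        gcongr; exact abs_symbol_le a ξ
    _ = _ := by ring

/-- The distributed order operator is the pseudo-differential operator with symbol `B`. -/
lemma distributedOp_eq (φ : 𝓢(Space N, ℂ)) (x : Space N) :
    distributedOp a φ x = invFourierF (fun ξ => (symbol a ξ : ℂ) * fourierF φ ξ) x := by
  have hf := continuous_fourierF_schwartz φ
  have h0 := integrable_fourierF_schwartz φ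
  have h2 := integrable_pow_mul_fourierF_schwartz φ 2
  simp only [distributedOp, fracLaplacian, invFourierF]
  rw [integral_const_mul, integral_integral_swap]
  · congr 1
    refine integral_congr_ae (.of_forall fun ξ => ?_)
    simp only
    rw [integral_mul_const, integral_mul_const, integral_complex_ofReal, integral_neg, symbol]
  · refine ((integrable_const (1 : ℝ) (μ := a.restrict (Ioc 0 2))).mul_prod
      (h0.norm.add h2)).mono' ?_ ?_
    · refine AEStronglyMeasurable.mul (AEStronglyMeasurable.mul ?_ ?_) (by fun_prop)
      · exact Measurable.aestronglyMeasurable (by fun_prop)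
      · exact (hf.comp continuous_snd).aestronglyMeasurable
    · have : ∀ᵐ p : ℝ × Space N ∂((a.restrict (Ioc 0 2)).prod volume), p.1 ∈ Ioc (0 : ℝ) 2 :=
        Measure.quasiMeasurePreserving_fst.ae (self_mem_ae_restrict measurableSet_Ioc)
      filter_upwards [this] with p hp
      simp only [Function.uncurry_def, norm_mul, norm_exp_I_mul_ofReal, mul_one, Complex.norm_real,
        norm_neg, one_mul, Pi.add_apply]
      rw [Real.norm_of_nonneg (by positivity)]
      calc _ ≤ (1 + ‖p.2‖ ^ 2) * ‖fourierF φ p.2‖ := by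
            gcongr
            exact rpow_le_one_add_sq (norm_nonneg _) hp
        _ = _ := by ring

/-- For s > 0 the factor e^{sB} is at most 1, so |B F φ| dominates all the derivatives. -/
lemma hasDerivAt_integral_exp_symbol (φ : 𝓢(Space N, ℂ)) {t : ℝ} (ht : 0 < t) :
    HasDerivAt (fun s : ℝ => ∫ ξ, (Real.exp (s * symbol a ξ) : ℂ) * fourierF φ ξ)
      (∫ ξ, (Real.exp (t * symbol a ξ) : ℂ) * ((symbol a ξ : ℂ) * fourierF φ ξ)) t := by
  have hc := continuous_symbol (N := N) a
  have hf := continuous_fourierF_schwartz φ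
  have hle : ∀ s : ℝ, 0 < s → ∀ ξ : Space N, ‖(Real.exp (s * symbol a ξ) : ℂ)‖ ≤ 1 := by
    intro s hs ξ
    rw [Complex.norm_real, Real.norm_of_nonneg (Real.exp_pos _).le]
    exact exp_symbol_le_one a hs.le ξ
  refine (hasDerivAt_integral_of_dominated_loc_of_deriv_le (s := Ioi 0)
    (F := fun s ξ => (Real.exp (s * symbol a ξ) : ℂ) * fourierF φ ξ)
    (F' := fun s ξ => (Real.exp (s * symbol a ξ) : ℂ) * ((symbol a ξ : ℂ) * fourierF φ ξ))
    (bound := fun ξ => ‖(symbol a ξ : ℂ) * fourierF φ ξ‖) (Ioi_mem_nhds ht)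
    (.of_forall fun s => Continuous.aestronglyMeasurable (by fun_prop)) ?_
    (Continuous.aestronglyMeasurable (by fun_prop)) ?_
    (integrable_symbol_mul_fourierF a φ).norm ?_).2
  · refine (integrable_fourierF_schwartz φ).mono (Continuous.aestronglyMeasurable (by fun_prop))
      (.of_forall fun ξ => ?_)
    rw [norm_mul]
    exact mul_le_of_le_one_left (norm_nonneg _) (hle t ht ξ)
  · refine .of_forall fun ξ s hs => ?_
    rw [norm_mul]
    exact mul_le_of_le_one_left (norm_nonneg _) (hle s hs ξ)
  · refine .of_forall fun ξ s _ => ?_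
    have h1 : HasDerivAt (fun s : ℝ => Real.exp (s * symbol a ξ))
        (Real.exp (s * symbol a ξ) * symbol a ξ) s := by
      simpa using ((hasDerivAt_id s).mul_const (symbol a ξ)).exp
    refine (h1.ofReal_comp.mul_const (fourierF φ ξ)).congr_deriv ?_
    push_cast; ring

lemma tendsto_integral_exp_symbol (φ : 𝓢(Space N, ℂ)) :
    Tendsto (fun s : ℝ => ∫ ξ, (Real.exp (s * symbol a ξ) : ℂ) * fourierF φ ξ) (𝓝[>] 0)
      (𝓝 (∫ ξ, fourierF φ ξ)) := by
  have hc := continuous_symbol (N := N) a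
  have hf := continuous_fourierF_schwartz φ
  refine tendsto_integral_filter_of_dominated_convergence (fun ξ => ‖fourierF φ ξ‖)
    (.of_forall fun s => Continuous.aestronglyMeasurable (by fun_prop)) ?_
    (integrable_fourierF_schwartz φ).norm (.of_forall fun ξ => ?_)
  · filter_upwards [self_mem_nhdsWithin] with s hs
    refine .of_forall fun ξ => ?_
    rw [norm_mul, Complex.norm_real, Real.norm_of_nonneg (Real.exp_pos _).le]
    exact mul_le_of_le_one_left (norm_nonneg _) (exp_symbol_le_one a (le_of_lt hs) ξ)
  · have h1 : Continuous fun s : ℝ => (Real.exp (s * symbol a ξ) : ℂ) * fourierF φ ξ := by fun_prop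
    have h2 := h1.tendsto 0
    simp only [zero_mul, Real.exp_zero, Complex.ofReal_one, one_mul] at h2
    exact h2.mono_left nhdsWithin_le_nhds

lemma isFundamentalSolution_G {a : Measure ℝ} [IsFiniteMeasure a] (ha_pos : 0 < a (Ioc 0 2))
    (hi : ∀ s : ℝ, 0 < s → Integrable (G a s : Space N → ℝ)) :
    IsFundamentalSolution (N := N) a (G a) := by
  have key : ∀ (φ : 𝓢(Space N, ℂ)) (s : ℝ), 0 < s → ∫ x, (G a s x : ℂ) * φ x =
      (((2 * Real.pi) ^ N : ℝ) : ℂ)⁻¹ * ∫ ξ, (Real.exp (s * symbol a ξ) : ℂ) * fourierF φ ξ := by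
    intro φ s hs
    rw [← integral_G_mul_invFourierF ha_pos hs (hi s hs) (integrable_fourierF_schwartz φ)]
    simp_rw [invFourierF_fourierF_schwartz]
  refine ⟨hi, fun φ t ht => ?_, fun φ => ?_⟩
  · simp_rw [distributedOp_eq]
    rw [integral_G_mul_invFourierF ha_pos ht (hi t ht) (integrable_symbol_mul_fourierF a φ)]
    refine ((hasDerivAt_integral_exp_symbol a φ ht).const_mul _).congr_of_eventuallyEq ?_
    filter_upwards [Ioi_mem_nhds ht] with s hs
    exact key φ s hs
  · have h0 : φ 0 = (((2 * Real.pi) ^ N : ℝ) : ℂ)⁻¹ * ∫ ξ, fourierF φ ξ := by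
      rw [← invFourierF_fourierF_schwartz, invFourierF]
      simp
    rw [h0]
    refine ((tendsto_integral_exp_symbol a φ).const_mul _).congr' ?_
    filter_upwards [self_mem_nhdsWithin] with s hs
    exact (key φ s hs).symm

end Equation

/-! ### The characteristic function of the walk, by independence. -/

section Walk

variable {N : ℕ} {a : Measure ℝ} [IsFiniteMeasure a] {Ω : Type*} [MeasurableSpace Ω]
  {P : Measure Ω} [IsProbabilityMeasure P]

lemma charFun_map_step (hN : 1 ≤ N) {τ h : ℝ} (hτ : 0 < τ) (hh : 0 < h) {Y : Ω → Fin N → ℤ}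
    (hY : Measurable Y) (hlaw : ∀ k, P.real (Y ⁻¹' {k}) = transitionProb a τ h k) (ξ : Space N) :
    charFun (P.map fun ω => node h (Y ω)) ξ =
      ((1 - τ * (latticeExponent a h ξ).toReal : ℝ) : ℂ) := by
  have hm : Measurable (node h : (Fin N → ℤ) → Space N) := measurable_of_countable _
  have : IsProbabilityMeasure (P.map Y) := Measure.isProbabilityMeasure_map hY.aemeasurable
  rw [← charFun_map_node hN a hτ hh (ν := P.map Y) fun k => by
    rw [map_measureReal_apply hY (measurableSet_singleton k), hlaw], Measure.map_map hm hY]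
  rfl

lemma charFun_map_walk (hN : 1 ≤ N) {τ h : ℝ} (hτ : 0 < τ) (hh : 0 < h) {n : ℕ}
    {X : Fin n → Ω → Fin N → ℤ} (hX : ∀ i, Measurable (X i)) (hind : iIndepFun X P)
    (hlaw : ∀ i k, P.real (X i ⁻¹' {k}) = transitionProb a τ h k) (ξ : Space N) :
    charFun (P.map fun ω => ∑ i, node h (X i ω)) ξ =
      (((1 - τ * (latticeExponent a h ξ).toReal) ^ n : ℝ) : ℂ) := by
  have hm : Measurable (node h : (Fin N → ℤ) → Space N) := measurable_of_countable _
  have h1 := (hind.comp (fun _ => node h) fun _ => hm).charFun_map_fun_sum_eq_prod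
    fun i => (hm.comp (hX i)).aemeasurable
  have h2 : ∀ i, charFun (P.map (node h ∘ X i)) ξ =
      ((1 - τ * (latticeExponent a h ξ).toReal : ℝ) : ℂ) := fun i =>
    charFun_map_step hN hτ hh (hX i) (hlaw i) ξ
  refine (congrFun h1 ξ).trans ?_
  rw [Finset.prod_apply, Finset.prod_congr rfl fun i _ => h2 i]
  simp

end Walk

end DistributedWalk

open DistributedWalk
theorem theorem3p1 (N : ℕ) (hN : 1 ≤ N)
    (a : Measure ℝ) [IsFiniteMeasure a] (ha_pos : 0 < a (Ioc 0 2)) (ha_two : a {2} = 0)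
    (t : ℝ) (ht : 0 < t)
    (h : ℕ → ℝ) (h_pos : ∀ n, 0 < h n) (h_lim : Tendsto h atTop (𝓝 0))
    (hσ : ∀ n : ℕ, 1 ≤ n → sigma N a (t / n) (h n) ≤ 1)
    {Ω : ℕ → Type*} [∀ n, MeasurableSpace (Ω n)]
    (P : ∀ n, Measure (Ω n)) [∀ n, IsProbabilityMeasure (P n)]
    (X : ∀ n, Fin n → Ω n → (Fin N → ℤ))
    (hX_meas : ∀ n i, Measurable (X n i))
    (hX_indep : ∀ n, iIndepFun (X n) (P n))
    (hX_law : ∀ n i k, (P n).real (X n i ⁻¹' {k}) = transitionProb a (t / n) (h n) k) :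
    -- `G = F⁻¹(e^{tB})` is real-valued and is a fundamental solution
    (∀ s : ℝ, 0 < s → ∀ x : Space N,
      (G a s x : ℂ) = invFourierF (fun ξ => Complex.exp ((s * symbol a ξ : ℝ) : ℂ)) x) ∧
    IsFundamentalSolution (N := N) a (G a) ∧
    -- `G(t, ·)` is a probability density
    IsProbabilityDensity (N := N) (G a t) ∧
    -- `S_n = h X_1 + ⋯ + h X_n` converges in law to a random vector with density `G(t, ·)`
    ∀ {Ω' : Type*} [MeasurableSpace Ω'] (P' : Measure Ω') [IsProbabilityMeasure P']
      (Z : Ω' → Space N),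
      HasLaw Z (volume.withDensity fun x => ENNReal.ofReal (G a t x)) P' →
      TendstoInDistribution (fun n ω => ∑ i : Fin n, node (h n) (X n i ω)) atTop Z P P' := by
  have hc : ∀ ξ : Space N, Tendsto (fun n => (latticeExponent a (h n) ξ).toReal) atTop
      (𝓝 (-symbol a ξ)) := by
    intro ξ
    have := (ENNReal.tendsto_toReal ENNReal.ofReal_ne_top).comp
      (tendsto_latticeExponent hN a ha_two ξ h_pos h_lim)
    rwa [ENNReal.toReal_ofReal (by linarith [symbol_nonpos a ξ])] at this
  have hstep : ∀ n : ℕ, ∃ μ : Measure (Space N), IsProbabilityMeasure μ ∧ (1 ≤ n → ∀ ξ,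
      charFun μ ξ = ((1 - t / n * (latticeExponent a (h n) ξ).toReal : ℝ) : ℂ)) := by
    intro n
    rcases Nat.eq_zero_or_pos n with rfl | hn
    -- For n = 0 there is no step to take a law from; any probability measure serves.
    · exact ⟨Measure.dirac 0, inferInstance, fun h0 => absurd h0 (by norm_num)⟩
    · have hm : Measurable (node (h n) : (Fin N → ℤ) → Space N) := measurable_of_countable _
      exact ⟨(P n).map fun ω => node (h n) (X n ⟨0, hn⟩ ω),
        Measure.isProbabilityMeasure_map (hm.comp (hX_meas n _)).aemeasurable,
        fun _ => charFun_map_step hN (by positivity) (h_pos n) (hX_meas n _) (hX_law n _)⟩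
  choose μ hμ hμc using hstep
  have happrox : ∀ s : ℝ, 0 < s → ∃ ν : ℕ → Measure (Space N),
      (∀ n, IsProbabilityMeasure (ν n)) ∧ ∀ ξ, Tendsto (fun n => charFun (ν n) ξ) atTop
        (𝓝 (Real.exp (s * symbol a ξ) : ℂ)) := by
    intro s hs
    simpa only [mul_neg, neg_neg] using exists_tendsto_charFun ht hμ hμc hc hs
  have hGi : ∀ s : ℝ, 0 < s → Integrable (G a s : Space N → ℝ) := by
    intro s hs
    obtain ⟨ν, hν, hlim⟩ := happrox s hs
    exact integrable_G ha_pos hs hlim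
  have hG0 : ∀ x : Space N, 0 ≤ G a t x := by
    obtain ⟨ν, hν, hlim⟩ := happrox t ht
    exact G_nonneg ha_pos ht hlim
  refine ⟨fun s hs x => ofReal_G_eq a ha_pos hs x, isFundamentalSolution_G ha_pos hGi,
    ⟨hG0, hGi t ht, integral_G ha_pos ht (hGi t ht)⟩, ?_⟩
  intro Ω' _ P' _ Z hZ
  have hS : ∀ n, Measurable fun ω => ∑ i : Fin n, node (h n) (X n i ω) := fun n =>
    Finset.measurable_sum _ fun i _ =>
      (measurable_of_countable (node (h n) : (Fin N → ℤ) → Space N)).comp (hX_meas n i)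
  refine ⟨fun n => (hS n).aemeasurable, hZ.aemeasurable,
    ProbabilityMeasure.tendsto_of_tendsto_charFun fun ξ => ?_⟩
  simp only [ProbabilityMeasure.coe_mk]
  rw [hZ.map_eq, charFun_withDensity_G ha_pos ht (hGi t ht) hG0]
  have h1 := tendsto_one_sub_div_mul_pow (hc ξ) t
  rw [mul_neg, neg_neg] at h1
  refine ((Complex.continuous_ofReal.tendsto _).comp h1).congr' ?_
  filter_upwards [eventually_ge_atTop 1] with n hn
  have hn0 : (0 : ℝ) < n := by exact_mod_cast hn
  exact (charFun_map_walk hN (by positivity) (h_pos n) (hX_meas n) (hX_indep n) (hX_law n) ξ).symm
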